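/- Let $m\ge 1$ and $c>0$. Equip $\mathbb R^{m+2}$ with $\langle v,w\rangle=-v_0w_0+\sum_{i=1}^{m+1}v_iw_i$ and let $\mathbb S_1^{m+1}(c)=\{x\in\mathbb R^{m+2}:\langle x,x\rangle=1/c\}$ be de Sitter space, with Levi-Civita connection $\bar\nabla$. Let $M$ be a compact connected smooth $m$-dimensional manifold and let $\varphi:M\to\mathbb S_1^{m+1}(c)$ be a smooth spacelike hypersurface, i.e. the metric $g=\varphi^*\langle\cdot,\cdot\rangle$ is positive definite. Let $\eta$ be a smooth unit normal field of $\varphi$ in $\mathbb S_1^{m+1}(c)$, so $\langle\eta,\eta\rangle=-1$, let $A$ be the shape operator, $\bar\nabla_v\eta=-d\varphi(Av)$, and let $f=-\frac1m\operatorname{trace}A$ be the mean curvature function. Suppose that - $(M,g)$ has non-negative sectional curvature and constant scalar curvature; - $M$ is non-minimal, i.e. $f$ does not vanish identically; - $M$ is biconservative, i.e. $A(\operatorname{grad} f)=\frac{mf}{2}\operatorname{grad} f$ on $M$, where $\operatorname{grad}$ is the gradient with respect to $g$. Then $M$ has constant mean curvature: $f$ is constant. -/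

import Mathlib

open scoped Manifold ContDiff

noncomputable section

namespace DeSitter

/-- The model space `ℝ^m` of an `m`-dimensional manifold. -/
abbrev Model (m : ℕ) : Type := EuclideanSpace ℝ (Fin m)

/-- The vector space `ℝ^{m+2}`, with coordinates `v 0, …, v (m+1)`. -/
abbrev Ambient (m : ℕ) : Type := EuclideanSpace ℝ (Fin (m + 2))

/-- The Lorentzian scalar product `⟨v, w⟩ = -v₀ w₀ + ∑_{i = 1}^{m+1} vᵢ wᵢ` on `ℝ^{m+2}`. -/
def lorentz (m : ℕ) : LinearMap.BilinForm ℝ (Ambient m) :=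
  LinearMap.mk₂ ℝ (fun v w => -(v 0 * w 0) + ∑ i : Fin (m + 1), v i.succ * w i.succ)
    (fun v v' w => by simp only [PiLp.add_apply, add_mul, Finset.sum_add_distrib]; ring)
    (fun a v w => by
      simp only [PiLp.smul_apply, smul_eq_mul, mul_assoc, ← Finset.mul_sum]; ring)
    (fun v w w' => by simp only [PiLp.add_apply, mul_add, Finset.sum_add_distrib]; ring)
    (fun a v w => by
      simp only [PiLp.smul_apply, smul_eq_mul, mul_left_comm _ a, ← Finset.mul_sum]; ring)

/-- De Sitter space `{x ∈ ℝ^{m+2} : ⟨x, x⟩ = 1 / c}`, of constant curvature `c`. -/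
def deSitterSpace (m : ℕ) (c : ℝ) : Set (Ambient m) := {x | lorentz m x x = 1 / c}

section Intrinsic

/-! ### Intrinsic geometry of a metric `g` on `M` -/

variable {m : ℕ} {M : Type*} [TopologicalSpace M] [ChartedSpace (Model m) M]

instance instFiniteDimensionalTangentSpace (p : M) :
    FiniteDimensional ℝ (TangentSpace 𝓘(ℝ, Model m) p) :=
  inferInstanceAs (FiniteDimensional ℝ (Model m))

variable (m M) in
/-- A field of bilinear forms on the tangent spaces of `M`. -/
abbrev FormField : Type _ := (p : M) → LinearMap.BilinForm ℝ (TangentSpace 𝓘(ℝ, Model m) p)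

open Classical in
/-- The index-raising map `T_p^* M → T_p M`: `sharp g p ω` is the vector with
`g_p (sharp g p ω, v) = ω v` for all `v`. (The value `0` for degenerate `g_p` is a dummy.) -/
def sharp (g : FormField m M) (p : M) :
    Module.Dual ℝ (TangentSpace 𝓘(ℝ, Model m) p) →ₗ[ℝ] TangentSpace 𝓘(ℝ, Model m) p :=
  if h : (g p).Nondegenerate then ((g p).toDual h).symm.toLinearMap else 0

/-- The gradient of `f` at `p`: `g_p (grad f, v) = df_p v`. -/
def gradient (g : FormField m M) (f : M → ℝ) (p : M) : TangentSpace 𝓘(ℝ, Model m) p :=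
  sharp g p (mfderiv 𝓘(ℝ, Model m) 𝓘(ℝ, ℝ) f p).toLinearMap

/-- The matrix `g_{ij}(u) = g(∂_i, ∂_j)` of `g` in the chart `x` around `p`, at the point with
coordinates `u`; here `∂_i = d(x⁻¹)_u (e_i)`. -/
def metricCoord (g : FormField m M) (p : M) (u : Model m) : Matrix (Fin m) (Fin m) ℝ :=
  Matrix.of fun i j =>
    g ((chartAt (Model m) p).symm u)
      (mfderiv 𝓘(ℝ, Model m) 𝓘(ℝ, Model m) (chartAt (Model m) p).symm u
        (EuclideanSpace.single i (1 : ℝ)))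
      (mfderiv 𝓘(ℝ, Model m) 𝓘(ℝ, Model m) (chartAt (Model m) p).symm u
        (EuclideanSpace.single j (1 : ℝ)))

/-- The partial derivative `∂_i F (u)`. -/
def partialDeriv (i : Fin m) (F : Model m → ℝ) (u : Model m) : ℝ :=
  fderiv ℝ F u (EuclideanSpace.single i (1 : ℝ))

/-- The Christoffel symbols of the Levi-Civita connection of `g` in the chart around `p`:
`Γ^k_{ij} = ½ ∑_l g^{kl} (∂_i g_{jl} + ∂_j g_{il} - ∂_l g_{ij})`. -/
def christoffel (g : FormField m M) (p : M) (k i j : Fin m) (u : Model m) : ℝ :=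
  (1 / 2) * ∑ l : Fin m, (metricCoord g p u)⁻¹ k l *
    (partialDeriv i (fun y => metricCoord g p y j l) u
      + partialDeriv j (fun y => metricCoord g p y i l) u
      - partialDeriv l (fun y => metricCoord g p y i j) u)

/-- The components at `p` of the curvature tensor of `g`, in the chart around `p`:
`R(∂_i, ∂_j) ∂_k = ∑_l R^l_{ijk} ∂_l`, where
`R(X, Y) Z = ∇_X ∇_Y Z - ∇_Y ∇_X Z - ∇_{[X, Y]} Z`. -/
def curvatureCoord (g : FormField m M) (p : M) (l i j k : Fin m) : ℝ :=
  let u := chartAt (Model m) p p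
  partialDeriv i (christoffel g p l j k) u - partialDeriv j (christoffel g p l i k) u
    + ∑ s : Fin m, (christoffel g p l i s u * christoffel g p s j k u
        - christoffel g p l j s u * christoffel g p s i k u)

/-- The scalar product `g_p (X, Y)` of `X = ∑ X^i ∂_i` and `Y = ∑ Y^j ∂_j`. -/
def innerCoord (g : FormField m M) (p : M) (X Y : Model m) : ℝ :=
  ∑ i : Fin m, ∑ j : Fin m, metricCoord g p (chartAt (Model m) p p) i j * X i * Y j

/-- The curvature `g_p (R(X, Y) Z, W)`, for vectors given by their components in the chart
around `p`. -/
def curvatureForm (g : FormField m M) (p : M) (X Y Z W : Model m) : ℝ :=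
  ∑ i : Fin m, ∑ j : Fin m, ∑ k : Fin m, ∑ l : Fin m, ∑ n : Fin m,
    curvatureCoord g p l i j k * metricCoord g p (chartAt (Model m) p p) l n
      * X i * Y j * Z k * W n

/-- The sectional curvature at `p` of the plane spanned by the linearly independent vectors
`X`, `Y`, given by their components in the chart around `p`. -/
def sectionalCurvature (g : FormField m M) (p : M) (X Y : Model m) : ℝ :=
  curvatureForm g p X Y Y X /
    (innerCoord g p X X * innerCoord g p Y Y - innerCoord g p X Y ^ 2)

/-- All sectional curvatures of `g` are non-negative. -/
def HasNonnegSectionalCurvature (g : FormField m M) : Prop :=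
  ∀ (p : M) (X Y : Model m), LinearIndependent ℝ ![X, Y] → 0 ≤ sectionalCurvature g p X Y

/-- The Ricci curvature `Ric(∂_j, ∂_k)` at `p`, the trace of `X ↦ R(X, ∂_j) ∂_k`. -/
def ricciCoord (g : FormField m M) (p : M) (j k : Fin m) : ℝ :=
  ∑ i : Fin m, curvatureCoord g p i i j k

/-- The scalar curvature at `p`, the `g`-trace of the Ricci curvature (not normalized). -/
def scalarCurvature (g : FormField m M) (p : M) : ℝ :=
  ∑ j : Fin m, ∑ k : Fin m,
    (metricCoord g p (chartAt (Model m) p p))⁻¹ j k * ricciCoord g p j k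

end Intrinsic

section Hypersurface

/-! ### Spacelike hypersurfaces -/

variable {m : ℕ} {M : Type*} [TopologicalSpace M] [ChartedSpace (Model m) M]

/-- The differential at `p` of a map `V : M → ℝ^{m+2}`. -/
def differential (V : M → Ambient m) (p : M) :
    TangentSpace 𝓘(ℝ, Model m) p →ₗ[ℝ] Ambient m :=
  (mfderiv 𝓘(ℝ, Model m) 𝓘(ℝ, Ambient m) V p).toLinearMap

/-- The form `g_p (v, w) = ⟨dφ_p v, dφ_p w⟩` induced on `M` by `φ`. -/
def inducedMetric (φ : M → Ambient m) : FormField m M := fun p =>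
  (lorentz m).compl₁₂ (differential φ p) (differential φ p)

/-- `φ` is a smooth map into de Sitter space whose induced form is positive definite. The last
condition makes `φ` an immersion, and `M`, of dimension `m`, has codimension one. -/
structure IsSpacelikeHypersurface (c : ℝ) (φ : M → Ambient m) : Prop where
  smooth : ContMDiff 𝓘(ℝ, Model m) 𝓘(ℝ, Ambient m) ∞ φ
  mem_deSitterSpace : ∀ p, φ p ∈ deSitterSpace m c
  spacelike : ∀ (p : M) (v : TangentSpace 𝓘(ℝ, Model m) p), v ≠ 0 → 0 < inducedMetric φ p v v

/-- `η` is a smooth field along `φ` that is tangent to de Sitter space (the tangent space at `x`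
is the orthogonal complement of `x`), normal to `M`, and of square `⟨η, η⟩ = -1`. -/
structure IsUnitNormalField (φ η : M → Ambient m) : Prop where
  smooth : ContMDiff 𝓘(ℝ, Model m) 𝓘(ℝ, Ambient m) ∞ η
  tangent : ∀ p, lorentz m (η p) (φ p) = 0
  normal : ∀ (p : M) (v : TangentSpace 𝓘(ℝ, Model m) p), lorentz m (η p) (differential φ p v) = 0
  unit : ∀ p, lorentz m (η p) (η p) = -1

/-- The Levi-Civita connection of de Sitter space, for a vector field `V` along `φ` that is tangent
to de Sitter space: `∇_v V` is the component `D_v V - c ⟨D_v V, φ⟩ φ`, tangent to de Sitter space,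
of the flat derivative `D_v V`. -/
def deSitterConnection (c : ℝ) (φ V : M → Ambient m) (p : M) :
    TangentSpace 𝓘(ℝ, Model m) p →ₗ[ℝ] Ambient m :=
  differential V p - c • ((lorentz m).flip (φ p) ∘ₗ differential V p).smulRight (φ p)

/-- The form `(v, w) ↦ ⟨A v, w⟩`, given by the Weingarten equation `∇_v η = -A v`. -/
def secondForm (c : ℝ) (φ η : M → Ambient m) : FormField m M := fun p =>
  -(lorentz m).compl₁₂ (deSitterConnection c φ η p) (differential φ p)

/-- The shape operator `A` of `φ` with respect to `η`: `dφ (A v) = -∇_v η`. -/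
def shapeOperator (c : ℝ) (φ η : M → Ambient m) (p : M) :
    TangentSpace 𝓘(ℝ, Model m) p →ₗ[ℝ] TangentSpace 𝓘(ℝ, Model m) p :=
  sharp (inducedMetric φ) p ∘ₗ secondForm c φ η p

/-- The mean curvature function `f`, with `trace A = -m f`. -/
def meanCurvature (c : ℝ) (φ η : M → Ambient m) (p : M) : ℝ :=
  -LinearMap.trace ℝ (TangentSpace 𝓘(ℝ, Model m) p) (shapeOperator c φ η p) / m

/-- The spacelike hypersurface is biconservative: `A (grad f) = (m f / 2) grad f`. -/
def IsBiconservative (c : ℝ) (φ η : M → Ambient m) : Prop :=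
  ∀ p : M, shapeOperator c φ η p (gradient (inducedMetric φ) (meanCurvature c φ η) p)
    = ((m : ℝ) * meanCurvature c φ η p / 2) •
        gradient (inducedMetric φ) (meanCurvature c φ η) p

/-- The hypersurface is minimal: its mean curvature vanishes identically. -/
def IsMinimal (c : ℝ) (φ η : M → Ambient m) : Prop := ∀ p : M, meanCurvature c φ η p = 0

end Hypersurface

end DeSitter

end

open scoped Manifold ContDiff

noncomputable section

namespace DeSitter

/-! ### The strong maximum principle, by Hopf's barrier argument. -/

section MaximumPrinciple

variable {E : Type*} [NormedAddCommGroup E] [InnerProductSpace ℝ E]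

/-! Put H = tr A = -m f. Since the scalar curvature is constant, the contracted Gauss equation
(`scalarCurvature_eq`) gives |A|² = H² + K with K constant. Biconservativity becomes A(grad H) =
-(H/2) grad H.

Two identities involve the quantity Σ λ_i H_ii, where λ_i are the principal curvatures. Simons'
formula, a consequence of Codazzi and the commutation of derivatives (`dd_dd_shape_comm`), says
½Δ|A|² = |∇A|² + Σ λ_i H_ii + ½ Σ (λ_i - λ_l)² (c - λ_i λ_l). Its left side is HΔH + |∇H|², and its
last term is non-negative because c - λ_i λ_l is the sectional curvature of a principal plane. On
the other hand, div A = grad H by Codazzi, so the divergence of the biconservative equation gives Σ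
λ_i H_ii = -(3/2)|∇H|² - ½HΔH. Eliminating Σ λ_i H_ii yields (3/2)HΔH + (5/2)|∇H|² ≥ 0
(`bochner_inequality`). Hence ΔH⁴ = 4H²(HΔH + 3|∇H|²) ≥ 0: the function H⁴ is subharmonic on a
compact connected manifold, so it is constant, and then so is H.

No covariant derivative of tensors is used. Every identity is verified at one point, in coordinates
whose frame is orthonormal and principal there and whose Christoffel symbols vanish there; such
coordinates come from an arbitrary chart by a quadratic substitution. Carried back to the chart
(`exists_elliptic_frame`), ΔH⁴ ≥ 0 becomes an elliptic inequality whose coefficients are chosen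
separately at each point, without continuity. The maximum principle `eq_of_elliptic_of_isMax`
therefore asks only for uniform bounds on them, and these follow from compactness of a closed
coordinate ball. It makes the set where H⁴ is maximal open as well as closed. -/

theorem fderiv_fderiv_nonpos_of_isLocalMax {F : E → ℝ} {x : E} (v : E)
    (hmax : IsLocalMax F x) (hF : ContDiffAt ℝ 2 F x) :
    fderiv ℝ (fun z => fderiv ℝ F z v) x v ≤ 0 := by
  by_contra! hpos
  have hline : ∀ t : ℝ, HasDerivAt (fun t : ℝ => x + t • v) v t := fun t => by
    simpa using ((hasDerivAt_id t).smul_const v).const_add x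
  have hcont : Filter.Tendsto (fun t : ℝ => x + t • v) (nhds 0) (nhds x) := by
    have : ContinuousAt (fun t : ℝ => x + t • v) 0 := (hline 0).continuousAt
    simpa [ContinuousAt] using this
  have hd : ∀ᶠ t in nhds (0 : ℝ),
      HasDerivAt (fun t : ℝ => F (x + t • v)) (fderiv ℝ F (x + t • v) v) t := by
    have h1 : ∀ᶠ z in nhds x, ContDiffAt ℝ 2 F z := hF.eventually (by simp)
    filter_upwards [hcont.eventually h1] with t ht
    exact (ht.differentiableAt (by norm_num)).hasFDerivAt.comp_hasDerivAt t (hline t)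
  have hderiv : deriv (fun t : ℝ => F (x + t • v)) =ᶠ[nhds 0]
      fun t => fderiv ℝ F (x + t • v) v := hd.mono fun t ht => ht.deriv
  have hdd : deriv (deriv (fun t : ℝ => F (x + t • v))) 0
      = fderiv ℝ (fun z => fderiv ℝ F z v) x v := by
    rw [hderiv.deriv_eq]
    have h2 : DifferentiableAt ℝ (fun z => fderiv ℝ F z v) x :=
      ((hF.fderiv_right (m := 1) (by norm_num)).differentiableAt (by norm_num)).clm_apply
        (differentiableAt_const v)
    have h3 : HasFDerivAt (fun z => fderiv ℝ F z v) (fderiv ℝ (fun z => fderiv ℝ F z v) x)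
        (x + (0 : ℝ) • v) := by simpa using h2.hasFDerivAt
    exact (h3.comp_hasDerivAt 0 (hline 0)).deriv
  have hmax0 : IsLocalMax (fun t : ℝ => F (x + t • v)) 0 := by
    have := hcont.eventually hmax
    simpa [IsLocalMax, IsMaxFilter] using this
  have hd0 := hmax0.deriv_eq_zero
  -- A positive second derivative would make 0 a local minimum as well, hence the function locally
  -- constant on the line and its second derivative zero.
  have hmin0 : IsLocalMin (fun t : ℝ => F (x + t • v)) 0 :=
    isLocalMin_of_deriv_deriv_pos (by rw [hdd]; exact hpos) hd0 hd.self_of_nhds.continuousAt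
  have hconst : (fun t : ℝ => F (x + t • v)) =ᶠ[nhds 0] fun _ => F (x + (0 : ℝ) • v) := by
    filter_upwards [hmax0, hmin0] with t h1 h2
    exact le_antisymm h1 h2
  have h4 : deriv (fun t : ℝ => F (x + t • v)) =ᶠ[nhds 0] fun _ => (0 : ℝ) := by
    have := hconst.deriv
    simpa using this
  have h5 : deriv (deriv (fun t : ℝ => F (x + t • v))) 0 = 0 := by
    rw [h4.deriv_eq]; simp
  rw [hdd] at h5
  exact hpos.ne' h5

/-- The Gaussian is Hopf's barrier: away from its centre the term in α² of its second derivatives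
outweighs all others once α is large. -/
theorem hasFDerivAt_gaussian (α : ℝ) (y z : E) :
    HasFDerivAt (fun x => Real.exp (-α * ‖x - y‖ ^ 2))
      ((-(2 * α) * Real.exp (-α * ‖z - y‖ ^ 2)) • innerSL ℝ (z - y)) z := by
  have h : HasFDerivAt (fun x => ‖x - y‖ ^ 2) (2 • innerSL ℝ (z - y)) z := by
    have := ((hasFDerivAt_id (𝕜 := ℝ) z).sub_const y).norm_sq
    refine this.congr_fderiv ?_
    ext v; simp
  refine ((h.const_mul (-α)).exp).congr_fderiv ?_
  ext v
  simp [-neg_mul]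
  ring

theorem fderiv_gaussian (α : ℝ) (y z v : E) :
    fderiv ℝ (fun x => Real.exp (-α * ‖x - y‖ ^ 2)) z v
      = -(2 * α) * Real.exp (-α * ‖z - y‖ ^ 2) * inner ℝ (z - y) v := by
  rw [(hasFDerivAt_gaussian α y z).fderiv]; simp [inner_sub_left]

theorem fderiv_fderiv_gaussian (α : ℝ) (y z v : E) :
    fderiv ℝ (fun x => fderiv ℝ (fun x => Real.exp (-α * ‖x - y‖ ^ 2)) x v) z v
      = Real.exp (-α * ‖z - y‖ ^ 2) * (4 * α ^ 2 * inner ℝ (z - y) v ^ 2 - 2 * α * ‖v‖ ^ 2) := by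
  simp_rw [fderiv_gaussian]
  have h2 : HasFDerivAt (fun x => inner ℝ (x - y) v) (innerSL ℝ v) z := by
    refine (((hasFDerivAt_id (𝕜 := ℝ) z).sub_const y).inner ℝ
      (hasFDerivAt_const v z)).congr_fderiv ?_
    ext w; simp [real_inner_comm]
  have h3 : HasFDerivAt (fun x => -(2 * α) * Real.exp (-α * ‖x - y‖ ^ 2) * inner ℝ (x - y) v)
      _ z := ((hasFDerivAt_gaussian α y z).const_mul (-(2 * α))).mul h2
  rw [h3.fderiv]
  simp [inner_sub_left]
  ring

theorem contDiff_gaussian (α : ℝ) (y : E) :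
    ContDiff ℝ 2 (fun x => Real.exp (-α * ‖x - y‖ ^ 2)) :=
  (contDiff_const.mul ((contDiff_id.sub contDiff_const).norm_sq ℝ)).exp

variable [FiniteDimensional ℝ E] {ι : Type*} [Fintype ι]

/-- Hopf's argument at a point `z` of maximum that lies on the boundary of a ball around `y` in
the interior of which the maximum is not attained. -/
theorem not_touching_of_elliptic {u : E → ℝ} {U : Set E} {lam Λ C : ℝ} (hU : IsOpen U)
    (hlam : 0 < lam) (hu : ∀ y ∈ U, ContDiffAt ℝ 2 u y)
    (hL : ∀ y ∈ U, ∃ (v : ι → E) (b : E), (∀ i, ‖v i‖ ≤ Λ) ∧ ‖b‖ ≤ C ∧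
      (∀ ξ, lam * ‖ξ‖ ^ 2 ≤ ∑ i, inner ℝ ξ (v i) ^ 2) ∧
      0 ≤ ∑ i, fderiv ℝ (fun z => fderiv ℝ u z (v i)) y (v i) + fderiv ℝ u y b)
    {y z : E} (hz : z ∈ U) (hyz : y ≠ z) (hmax : ∀ x ∈ U, u x ≤ u z)
    (hlt : ∀ x ∈ U, dist x y ≤ dist z y → x ≠ z → u x < u z) : False := by
  set r := dist z y with hr
  have hrpos : 0 < r := dist_pos.2 hyz.symm
  obtain ⟨ρ₀, hρ₀, hball⟩ := Metric.isOpen_iff.1 hU z hz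
  -- The bound ρ ≤ r / 2 keeps the small ball away from `y`, where the gradient of the barrier
  -- vanishes: on it, r / 2 ≤ ‖x - y‖ ≤ 2r.
  obtain ⟨ρ, hρ, hρr, hρ1⟩ : ∃ ρ, 0 < ρ ∧ ρ ≤ r / 2 ∧ ρ < ρ₀ :=
    ⟨min (r / 2) (ρ₀ / 2), by positivity, min_le_left _ _,
      (min_le_right _ _).trans_lt (by linarith)⟩
  have hsub : Metric.closedBall z ρ ⊆ U := fun x hx =>
    hball (lt_of_le_of_lt (Metric.mem_closedBall.1 hx) hρ1)
  -- This is positivity of the operator on the barrier: the right side bounds 2α Σ ⟨x - y, v i⟩²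
  -- from below, the left side bounds Σ ‖v i‖² + ⟨x - y, b⟩ from above.
  obtain ⟨α, hα, hαpos⟩ : ∃ α : ℝ, 0 < α ∧ (Fintype.card ι * Λ ^ 2) + (2 * r) * C
      < 2 * α * lam * (r / 2) ^ 2 := by
    obtain ⟨n, hn⟩ := exists_nat_gt (((Fintype.card ι * Λ ^ 2) + (2 * r) * C) /
      (2 * lam * (r / 2) ^ 2))
    refine ⟨n + 1, by positivity, ?_⟩
    rw [div_lt_iff₀ (by positivity)] at hn
    nlinarith [show 0 < 2 * lam * (r / 2) ^ 2 by positivity]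
  set g : E → ℝ := fun x => Real.exp (-α * ‖x - y‖ ^ 2) with hg
  set k := Real.exp (-α * r ^ 2) with hk
  have hgz : g z = k := by simp [hg, hk, hr, dist_eq_norm]
  have hg_out : ∀ x, r < dist x y → g x < k := fun x hx => by
    rw [dist_eq_norm] at hx
    simp only [hg, hk]
    apply Real.exp_lt_exp.2
    nlinarith [mul_pos hα (sub_pos.2 hx)]
  have hg_le : ∀ x, g x ≤ 1 := fun x => by
    simp only [hg]
    apply Real.exp_le_one_iff.2
    nlinarith [mul_nonneg hα.le (sq_nonneg ‖x - y‖)]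
  have hkpos : 0 < k := Real.exp_pos _
  have hLg : ∀ x ∈ Metric.closedBall z ρ, ∀ (v : ι → E) (b : E), (∀ i, ‖v i‖ ≤ Λ) → ‖b‖ ≤ C →
      (∀ ξ, lam * ‖ξ‖ ^ 2 ≤ ∑ i, inner ℝ ξ (v i) ^ 2) →
      0 < ∑ i, fderiv ℝ (fun z => fderiv ℝ g z (v i)) x (v i) + fderiv ℝ g x b := by
    intro x hx v b hv hb hξ
    simp only [hg, fderiv_fderiv_gaussian]
    rw [fderiv_gaussian]
    rw [← Finset.mul_sum, Finset.sum_sub_distrib, ← Finset.mul_sum, ← Finset.mul_sum]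
    have hxy1 : r / 2 ≤ ‖x - y‖ := by
      rw [← dist_eq_norm]
      have := dist_triangle z x y
      rw [dist_comm z x] at this
      have := Metric.mem_closedBall.1 hx
      linarith
    have hxy2 : ‖x - y‖ ≤ 2 * r := by
      rw [← dist_eq_norm]
      have := dist_triangle x z y
      have := Metric.mem_closedBall.1 hx
      linarith
    have h1 := hξ (x - y)
    have h2 : ∑ i, ‖v i‖ ^ 2 ≤ Fintype.card ι * Λ ^ 2 := by
      calc ∑ i, ‖v i‖ ^ 2 ≤ ∑ _i : ι, Λ ^ 2 :=
            Finset.sum_le_sum fun i _ => pow_le_pow_left₀ (norm_nonneg _) (hv i) 2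
        _ = _ := by simp
    have h3 : inner ℝ (x - y) b ≤ (2 * r) * C :=
      (real_inner_le_norm _ _).trans (mul_le_mul hxy2 hb (norm_nonneg _) (by positivity))
    have h4 : (r / 2) ^ 2 ≤ ‖x - y‖ ^ 2 := pow_le_pow_left₀ (by positivity) hxy1 2
    have h5 : lam * (r / 2) ^ 2 ≤ ∑ i, inner ℝ (x - y) (v i) ^ 2 :=
      (mul_le_mul_of_nonneg_left h4 hlam.le).trans h1
    have h6 : 0 < 2 * α * (∑ i, inner ℝ (x - y) (v i) ^ 2) - ∑ i, ‖v i‖ ^ 2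
        - inner ℝ (x - y) b := by
      nlinarith [mul_le_mul_of_nonneg_left h5 hα.le]
    have h7 := mul_pos (mul_pos (mul_pos two_pos hα) (Real.exp_pos (-α * ‖x - y‖ ^ 2))) h6
    nlinarith [h7]
  -- a uniform gap on the part of the sphere inside the closed ball
  obtain ⟨δ, hδ, hgap⟩ : ∃ δ : ℝ, 0 < δ ∧ ∀ x ∈ Metric.sphere z ρ, dist x y ≤ r →
      u x ≤ u z - δ := by
    set K := Metric.sphere z ρ ∩ Metric.closedBall y r with hK
    have hKc : IsCompact K := (isCompact_sphere z ρ).inter_right Metric.isClosed_closedBall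
    have hKU : ∀ x ∈ K, x ∈ U := fun x hx => hsub (Metric.sphere_subset_closedBall hx.1)
    rcases K.eq_empty_or_nonempty with h0 | h0
    · exact ⟨1, one_pos, fun x hx hxy => absurd (show x ∈ K from ⟨hx, hxy⟩) (by simp [h0])⟩
    · obtain ⟨x₁, hx₁, hx₁max⟩ := hKc.exists_isMaxOn h0
        (f := u) (fun x hx => (hu x (hKU x hx)).continuousAt.continuousWithinAt)
      refine ⟨u z - u x₁, sub_pos.2 (hlt x₁ (hKU _ hx₁) hx₁.2 ?_), fun x hx hxy => ?_⟩
      · rintro rfl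
        have := Metric.mem_sphere.1 hx₁.1
        simp at this
        exact hρ.ne this
      · have := hx₁max (show x ∈ K from ⟨hx, hxy⟩)
        simp only [Set.mem_ofPred_eq] at this
        linarith
  -- Inside the large ball `u` has dropped by δ and ε g ≤ δ / 2; outside it g is already below its
  -- value at `z`. So u + ε g is smaller on the small sphere than at `z`.
  set ε := δ / 2 with hε
  have hεpos : 0 < ε := by positivity
  set F : E → ℝ := fun x => u x + ε * g x with hF
  have hsphere : ∀ x ∈ Metric.sphere z ρ, F x < F z := by
    intro x hx
    simp only [hF, hgz]
    rcases le_or_gt (dist x y) r with h | h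
    · have := hgap x hx h
      nlinarith [hg_le x, mul_le_mul_of_nonneg_left (hg_le x) hεpos.le, mul_pos hεpos hkpos]
    · have := hmax x (hsub (Metric.sphere_subset_closedBall hx))
      nlinarith [mul_lt_mul_of_pos_left (hg_out x h) hεpos]
  have hgC : ∀ x, ContDiffAt ℝ 2 g x := fun x => (contDiff_gaussian α y).contDiffAt
  have hFC : ∀ x ∈ U, ContDiffAt ℝ 2 F x := fun x hx =>
    (hu x hx).add (contDiffAt_const.mul (hgC x))
  obtain ⟨x, hx, hxmax⟩ := (isCompact_closedBall z ρ).exists_isMaxOn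
    (Metric.nonempty_closedBall.2 hρ.le)
    (f := F) (fun x hx => (hFC x (hsub hx)).continuousAt.continuousWithinAt)
  have hxball : x ∈ Metric.ball z ρ := by
    rcases (Metric.mem_closedBall.1 hx).lt_or_eq with h | h
    · exact h
    · exact absurd (hxmax (Metric.mem_closedBall_self hρ.le)) (not_le.2 (hsphere x h))
  have hloc : IsLocalMax F x := hxmax.isLocalMax (Metric.closedBall_mem_nhds_of_mem hxball)
  have hxU := hsub hx
  obtain ⟨v, b, hv, hb, hξ, hLu⟩ := hL x hxU
  have hpos := hLg x hx v b hv hb hξ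
  have hUn : U ∈ nhds x := hU.mem_nhds hxU
  have hfd : ∀ z ∈ U, ∀ w, fderiv ℝ F z w = fderiv ℝ u z w + ε * fderiv ℝ g z w := by
    intro z hz w
    have h1 := ((hu z hz).differentiableAt (by norm_num)).hasFDerivAt
    have h2 := ((hgC z).differentiableAt (by norm_num)).hasFDerivAt
    have h3 : HasFDerivAt F _ z := h1.add (h2.const_mul ε)
    rw [h3.fderiv]
    simp
  have hfdd : ∀ w, fderiv ℝ (fun z => fderiv ℝ F z w) x w
      = fderiv ℝ (fun z => fderiv ℝ u z w) x w
        + ε * fderiv ℝ (fun z => fderiv ℝ g z w) x w := by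
    intro w
    have he : (fun z => fderiv ℝ F z w) =ᶠ[nhds x]
        fun z => fderiv ℝ u z w + ε * fderiv ℝ g z w := by
      filter_upwards [hUn] with z hz using hfd z hz w
    rw [he.fderiv_eq]
    have h1 : DifferentiableAt ℝ (fun z => fderiv ℝ u z w) x :=
      (((hu x hxU).fderiv_right (m := 1) (by norm_num)).differentiableAt (by norm_num)).clm_apply
        (differentiableAt_const w)
    have h2 : DifferentiableAt ℝ (fun z => fderiv ℝ g z w) x :=
      (((hgC x).fderiv_right (m := 1) (by norm_num)).differentiableAt (by norm_num)).clm_apply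
        (differentiableAt_const w)
    have h3 : HasFDerivAt (fun z => fderiv ℝ u z w + ε * fderiv ℝ g z w) _ x :=
      h1.hasFDerivAt.add (h2.hasFDerivAt.const_mul ε)
    rw [h3.fderiv]
    simp
  -- At the interior maximum of u + ε g the operator gives a value ≤ 0, while it is ≥ 0 on `u` and >
  -- 0 on `g`.
  have hF0 : fderiv ℝ F x b = 0 := by rw [hloc.fderiv_eq_zero]; simp
  have hF2 : ∑ i, fderiv ℝ (fun z => fderiv ℝ F z (v i)) x (v i) ≤ 0 :=
    Finset.sum_nonpos fun i _ => fderiv_fderiv_nonpos_of_isLocalMax (v i) hloc (hFC x hxU)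
  simp only [hfdd, Finset.sum_add_distrib, ← Finset.mul_sum] at hF2
  rw [hfd x hxU] at hF0
  nlinarith [mul_pos hεpos hpos]

/-- The strong maximum principle: a function satisfying a locally uniformly elliptic differential
inequality on a ball, with a maximum at the centre, is constant near the centre. -/
theorem eq_of_elliptic_of_isMax {u : E → ℝ} {x₀ : E} {R lam Λ C : ℝ}
    (hlam : 0 < lam) (hu : ∀ y ∈ Metric.ball x₀ R, ContDiffAt ℝ 2 u y)
    (hL : ∀ y ∈ Metric.ball x₀ R, ∃ (v : ι → E) (b : E), (∀ i, ‖v i‖ ≤ Λ) ∧ ‖b‖ ≤ C ∧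
      (∀ ξ, lam * ‖ξ‖ ^ 2 ≤ ∑ i, inner ℝ ξ (v i) ^ 2) ∧
      0 ≤ ∑ i, fderiv ℝ (fun z => fderiv ℝ u z (v i)) y (v i) + fderiv ℝ u y b)
    (hmax : ∀ y ∈ Metric.ball x₀ R, u y ≤ u x₀) :
    ∀ y ∈ Metric.ball x₀ (R / 2), u y = u x₀ := by
  intro y hy
  by_contra hne
  have hy' := Metric.mem_ball.1 hy
  have hR : 0 < R := by have := dist_nonneg.trans_lt hy'; linarith
  set d := dist y x₀ with hd
  set K := {x ∈ Metric.closedBall y d | u x = u x₀} with hK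
  have hsub : Metric.closedBall y d ⊆ Metric.ball x₀ R := fun x hx => by
    have := dist_triangle x y x₀
    have := Metric.mem_closedBall.1 hx
    rw [Metric.mem_ball]; linarith
  have hKc : IsCompact K := by
    have hc : ContinuousOn u (Metric.closedBall y d) := fun x hx =>
      (hu x (hsub hx)).continuousAt.continuousWithinAt
    exact (isCompact_closedBall y d).of_isClosed_subset
      (hc.preimage_isClosed_of_isClosed Metric.isClosed_closedBall isClosed_singleton)
      (fun x hx => hx.1)
  have hKne : K.Nonempty := ⟨x₀, by simp [hd, dist_comm], rfl⟩
  -- `z` is a point nearest to `y` among those of the closed ball where the maximum is attained.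
  obtain ⟨z, hz, hzmin⟩ := hKc.exists_isMinOn hKne (f := fun x => dist x y)
    (continuous_id.dist continuous_const).continuousOn
  have hzR := hsub hz.1
  have hyz : y ≠ z := by
    rintro rfl
    exact hne hz.2
  have hmin : ∀ x, dist x y < dist z y → u x ≠ u x₀ := fun x hx hux => by
    have : x ∈ K := ⟨Metric.mem_closedBall.2 (hx.le.trans hz.1), hux⟩
    exact absurd (hzmin this) (not_le.2 hx)
  -- Halving the ball makes it internally tangent at `z`, so that `z` is its only point where the
  -- maximum is attained; the original ball could have several on its boundary.
  refine not_touching_of_elliptic (y := midpoint ℝ y z) Metric.isOpen_ball hlam hu hL hzR ?_ ?_ ?_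
  · intro h
    exact hyz ((midpoint_eq_right_iff ℝ).1 h)
  · intro x hx
    rw [hz.2]; exact hmax x hx
  · intro x hx hxm hxz
    rw [hz.2]
    refine lt_of_le_of_ne (hmax x hx) (hmin x ?_)
    set m := midpoint ℝ y z
    have h1 : dist z m = dist z y / 2 := by
      rw [dist_comm z m, dist_midpoint_right, dist_comm y z]; simp; ring
    have h2 : dist m y = dist z y / 2 := by
      rw [dist_midpoint_left, dist_comm y z]; simp; ring
    rcases lt_or_ge (dist x y) (dist z y) with h | h
    · exact h
    exfalso
    have h3 := dist_triangle x m y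
    have h4 : dist x m = dist z m := by linarith
    have h5 : dist x y = dist z y := by linarith
    apply hxz
    have h6 : dist x m + dist m y = dist x y := by linarith
    -- Equality in the triangle inequality, with both summands of the same length, forces x - m = m
    -- - y by strict convexity.
    have h7 : ‖(x - m) + (m - y)‖ = ‖x - m‖ + ‖m - y‖ := by
      rw [sub_add_sub_cancel, ← dist_eq_norm, ← dist_eq_norm, ← dist_eq_norm, h6]
    have h8 : ‖x - m‖ = ‖m - y‖ := by rw [← dist_eq_norm, ← dist_eq_norm]; linarith
    have h9 : x - m = m - y := by
      have := sameRay_iff_norm_add.2 h7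
      exact this.norm_eq_iff.1 h8
    have h10 : z - m = m - y := by
      simp only [m, midpoint_eq_smul_add, invOf_eq_inv]
      module
    have h11 := h9.trans h10.symm
    exact sub_left_injective h11

end MaximumPrinciple

/-! ### Rules for coordinate derivatives of vector-valued maps. -/

section LocalCalculus

variable {m : ℕ} {V W Z : Type*} [NormedAddCommGroup V] [NormedSpace ℝ V]
  [NormedAddCommGroup W] [NormedSpace ℝ W] [NormedAddCommGroup Z] [NormedSpace ℝ Z]

/-- The partial derivative `∂_i F` of a vector-valued function. -/
def dd (i : Fin m) (F : Model m → V) : Model m → V :=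
  fun y => fderiv ℝ F y (EuclideanSpace.single i (1 : ℝ))

/-- `F` is smooth at all points of `U`. -/
def IsSmoothOn (U : Set (Model m)) (F : Model m → V) : Prop := ∀ y ∈ U, ContDiffAt ℝ ∞ F y

variable {U : Set (Model m)} {x : Model m}

theorem IsSmoothOn.differentiableAt {F : Model m → V} (h : IsSmoothOn U F) (hx : x ∈ U) :
    DifferentiableAt ℝ F x := (h x hx).differentiableAt (by simp)

theorem IsSmoothOn.dd {F : Model m → V} (h : IsSmoothOn U F) (i : Fin m) :
    IsSmoothOn U (dd i F) := fun y hy =>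
  ((h y hy).fderiv_right (m := ∞) (by simp)).clm_apply contDiffAt_const

theorem IsSmoothOn.bilin {F : Model m → V} {G : Model m → W} (B : V →L[ℝ] W →L[ℝ] Z)
    (hF : IsSmoothOn U F) (hG : IsSmoothOn U G) : IsSmoothOn U (fun y => B (F y) (G y)) :=
  fun y hy => (B.contDiff.contDiffAt.comp y (hF y hy)).clm_apply (hG y hy)

theorem IsSmoothOn.mul {f g : Model m → ℝ} (hf : IsSmoothOn U f) (hg : IsSmoothOn U g) :
    IsSmoothOn U (fun y => f y * g y) := fun y hy => (hf y hy).mul (hg y hy)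

theorem IsSmoothOn.smul {f : Model m → ℝ} {G : Model m → V} (hf : IsSmoothOn U f)
    (hG : IsSmoothOn U G) : IsSmoothOn U (fun y => f y • G y) :=
  fun y hy => (hf y hy).smul (hG y hy)

theorem IsSmoothOn.sum {ι : Type*} [Fintype ι] {F : ι → Model m → V}
    (h : ∀ i, IsSmoothOn U (F i)) : IsSmoothOn U (fun y => ∑ i, F i y) :=
  fun y hy => ContDiffAt.sum fun i _ => h i y hy

theorem dd_congr {F G : Model m → V} (hU : IsOpen U) (h : ∀ y ∈ U, F y = G y) (i : Fin m) :
    ∀ y ∈ U, dd i F y = dd i G y := fun y hy => by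
  have : F =ᶠ[nhds y] G := by
    filter_upwards [hU.mem_nhds hy] with z hz using h z hz
  simp only [dd, this.fderiv_eq]

theorem dd_comm {F : Model m → V} (h : IsSmoothOn U F) (hx : x ∈ U) (i j : Fin m) :
    dd i (dd j F) x = dd j (dd i F) x := by
  have hs : IsSymmSndFDerivAt ℝ F x := (h x hx).isSymmSndFDerivAt
    (by rw [minSmoothness_of_isRCLikeNormedField]; exact ENat.LEInfty.out)
  have key : ∀ v w : Model m, fderiv ℝ (fun y => fderiv ℝ F y v) x w
      = fderiv ℝ (fderiv ℝ F) x w v := fun v w => by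
    have hd : DifferentiableAt ℝ (fderiv ℝ F) x :=
      ((h x hx).fderiv_right (m := ∞) (by simp)).differentiableAt (by simp)
    rw [fderiv_clm_apply hd (differentiableAt_const v)]
    simp
  unfold dd
  rw [key, key]
  exact hs _ _

theorem dd_const (v : V) (i : Fin m) (x : Model m) : dd i (fun _ => v) x = 0 := by
  simp [dd]

theorem dd_sum {ι : Type*} [Fintype ι] {F : ι → Model m → V} (h : ∀ i, IsSmoothOn U (F i))
    (hx : x ∈ U) (k : Fin m) : dd k (fun y => ∑ i, F i y) x = ∑ i, dd k (F i) x := by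
  unfold dd
  rw [fderiv_fun_sum fun i _ => (h i).differentiableAt hx]
  simp

theorem dd_add {F G : Model m → V} (hF : IsSmoothOn U F) (hG : IsSmoothOn U G)
    (hx : x ∈ U) (k : Fin m) : dd k (fun y => F y + G y) x = dd k F x + dd k G x := by
  unfold dd
  rw [fderiv_fun_add (hF.differentiableAt hx) (hG.differentiableAt hx)]
  simp

theorem dd_neg {F : Model m → V} (k : Fin m) : dd k (fun y => -F y) x = -dd k F x := by
  unfold dd
  rw [fderiv_fun_neg]
  simp

theorem dd_bilin {F : Model m → V} {G : Model m → W} (B : V →L[ℝ] W →L[ℝ] Z)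
    (hF : IsSmoothOn U F) (hG : IsSmoothOn U G) (hx : x ∈ U) (k : Fin m) :
    dd k (fun y => B (F y) (G y)) x = B (dd k F x) (G x) + B (F x) (dd k G x) := by
  unfold dd
  rw [(B.hasFDerivAt_of_bilinear (hF.differentiableAt hx).hasFDerivAt
    (hG.differentiableAt hx).hasFDerivAt).fderiv]
  simp [add_comm]

theorem dd_mul {f g : Model m → ℝ} (hf : IsSmoothOn U f) (hg : IsSmoothOn U g) (hx : x ∈ U)
    (k : Fin m) : dd k (fun y => f y * g y) x = dd k f x * g x + f x * dd k g x :=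
  dd_bilin (ContinuousLinearMap.mul ℝ ℝ) hf hg hx k

theorem dd_smul {f : Model m → ℝ} {G : Model m → V} (hf : IsSmoothOn U f)
    (hG : IsSmoothOn U G) (hx : x ∈ U) (k : Fin m) :
    dd k (fun y => f y • G y) x = dd k f x • G x + f x • dd k G x :=
  dd_bilin (ContinuousLinearMap.lsmul ℝ ℝ) hf hG hx k

theorem dd_dd_bilin {F : Model m → V} {G : Model m → W} (B : V →L[ℝ] W →L[ℝ] Z)
    (hU : IsOpen U) (hF : IsSmoothOn U F) (hG : IsSmoothOn U G) (hx : x ∈ U) (l k : Fin m) :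
    dd l (dd k (fun y => B (F y) (G y))) x = B (dd l (dd k F) x) (G x) + B (dd k F x) (dd l G x)
      + (B (dd l F x) (dd k G x) + B (F x) (dd l (dd k G) x)) := by
  rw [dd_congr hU (fun y hy => dd_bilin B hF hG hy k) l x hx,
    dd_add ((hF.dd k).bilin B hG) (hF.bilin B (hG.dd k)) hx, dd_bilin B (hF.dd k) hG hx,
    dd_bilin B hF (hG.dd k) hx]

theorem dd_dd_mul {f g : Model m → ℝ} (hU : IsOpen U) (hf : IsSmoothOn U f)
    (hg : IsSmoothOn U g) (hx : x ∈ U) (l k : Fin m) :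
    dd l (dd k (fun y => f y * g y)) x = dd l (dd k f) x * g x + dd k f x * dd l g x
      + (dd l f x * dd k g x + f x * dd l (dd k g) x) :=
  dd_dd_bilin (ContinuousLinearMap.mul ℝ ℝ) hU hf hg hx l k

theorem dd_dd_sum {ι : Type*} [Fintype ι] {F : ι → Model m → V} (hU : IsOpen U)
    (h : ∀ i, IsSmoothOn U (F i)) (hx : x ∈ U) (l k : Fin m) :
    dd l (dd k (fun y => ∑ i, F i y)) x = ∑ i, dd l (dd k (F i)) x := by
  rw [dd_congr hU (fun y hy => dd_sum h hy k) l x hx, dd_sum (fun i => (h i).dd k) hx]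

end LocalCalculus

/-! ### Structure equations of a parametrized hypersurface. -/

section LocalHypersurface

variable {m : ℕ} {V : Type*} [NormedAddCommGroup V] [NormedSpace ℝ V]

/-- A parametrized spacelike hypersurface `X`, defined on an open set `U`, of the pseudosphere of
curvature `c` in a space `V` with a scalar product `B`. The unit normal is `N`, and `a` is the
matrix of the shape operator in the coordinate frame. -/
structure IsLocalHypersurface (B : V →L[ℝ] V →L[ℝ] ℝ) (c : ℝ) (U : Set (Model m))
    (X N : Model m → V) (a : Fin m → Fin m → Model m → ℝ) : Prop where
  symm : ∀ v w, B v w = B w v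
  isOpen : IsOpen U
  smooth : IsSmoothOn U X
  smooth_normal : IsSmoothOn U N
  smooth_shape : ∀ i j, IsSmoothOn U (a i j)
  sq : ∀ y ∈ U, c * B (X y) (X y) = 1
  sq_normal : ∀ y ∈ U, B (N y) (N y) = -1
  normal_pos : ∀ y ∈ U, B (N y) (X y) = 0
  normal : ∀ i, ∀ y ∈ U, B (N y) (dd i X y) = 0
  weingarten : ∀ j, ∀ y ∈ U, dd j N y = -∑ i, a i j y • dd i X y
  eq_zero : ∀ y ∈ U, ∀ v, B v (X y) = 0 → B v (N y) = 0 → (∀ i, B v (dd i X y) = 0) → v = 0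

variable {B : V →L[ℝ] V →L[ℝ] ℝ} {c : ℝ} {U : Set (Model m)} {X N : Model m → V}
  {a : Fin m → Fin m → Model m → ℝ} {x : Model m}

namespace IsLocalHypersurface

theorem pos_tangent (h : IsLocalHypersurface B c U X N a) (hx : x ∈ U) (i : Fin m) :
    c * B (X x) (dd i X x) = 0 := by
  have h1 := dd_congr h.isOpen (F := fun y => B (X y) (c • X y)) (G := fun _ => (1 : ℝ))
    (fun y hy => by simpa using h.sq y hy) i x hx
  have h2 : IsSmoothOn U (fun y => c • X y) := fun y hy => contDiffAt_const.smul (h.smooth y hy)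
  rw [dd_const, dd_bilin B h.smooth h2 hx] at h1
  have h3 : dd i (fun y => c • X y) x = c • dd i X x := by
    unfold dd
    rw [fderiv_fun_const_smul (h.smooth.differentiableAt hx)]; simp
  rw [h3, map_smul, map_smul, h.symm (dd i X x)] at h1
  simp only [smul_eq_mul] at h1
  linarith

theorem c_ne_zero (h : IsLocalHypersurface B c U X N a) (hx : x ∈ U) : c ≠ 0 := by
  rintro rfl
  simpa using h.sq x hx

theorem pos_tangent' (h : IsLocalHypersurface B c U X N a) (hx : x ∈ U) (i : Fin m) :
    B (X x) (dd i X x) = 0 :=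
  (mul_eq_zero.1 (h.pos_tangent hx i)).resolve_left (h.c_ne_zero hx)

theorem pos_second (h : IsLocalHypersurface B c U X N a) (hx : x ∈ U) (i j : Fin m) :
    B (X x) (dd i (dd j X) x) = -B (dd i X x) (dd j X x) := by
  have h1 := dd_congr h.isOpen (F := fun y => B (X y) (dd j X y)) (G := fun _ => (0 : ℝ))
    (fun y hy => h.pos_tangent' hy j) i x hx
  rw [dd_const, dd_bilin B h.smooth (h.smooth.dd j) hx] at h1
  linarith

/-- Differentiate ⟨N, ∂_j X⟩ = 0 and insert the Weingarten equation. -/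
theorem normal_second (h : IsLocalHypersurface B c U X N a) (hx : x ∈ U) (i j : Fin m) :
    B (N x) (dd i (dd j X) x) = ∑ k, a k i x * B (dd k X x) (dd j X x) := by
  have h1 := dd_congr h.isOpen (F := fun y => B (N y) (dd j X y)) (G := fun _ => (0 : ℝ))
    (fun y hy => h.normal j y hy) i x hx
  rw [dd_const, dd_bilin B h.smooth_normal (h.smooth.dd j) hx, h.weingarten i x hx] at h1
  simp only [map_neg, map_sum, map_smul, neg_apply,
    sum_apply, smul_apply, smul_eq_mul] at h1
  linarith

/-- Both sides are the pairing of `N` with a second derivative of `X`, and ∂_i ∂_j X is symmetric.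
-/
theorem shape_symm (h : IsLocalHypersurface B c U X N a) (hx : x ∈ U) (i j : Fin m) :
    ∑ k, a k i x * B (dd k X x) (dd j X x) = ∑ k, a k j x * B (dd k X x) (dd i X x) := by
  rw [← h.normal_second hx, ← h.normal_second hx, dd_comm h.smooth hx]

/-- The Gauss formula. -/
theorem second_eq (h : IsLocalHypersurface B c U X N a) (hx : x ∈ U) (i j : Fin m)
    (Γ : Fin m → ℝ)
    (hΓ : ∀ n, ∑ k, Γ k * B (dd k X x) (dd n X x) = B (dd i (dd j X) x) (dd n X x)) :
    dd i (dd j X) x = ∑ k, Γ k • dd k X x - (c * B (dd i X x) (dd j X x)) • X x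
      - (∑ k, a k i x * B (dd k X x) (dd j X x)) • N x := by
  rw [← sub_eq_zero]
  -- The difference is orthogonal to X, N and every ∂_n X. The coefficient of N carries a minus sign
  -- because ⟨N, N⟩ = -1.
  apply h.eq_zero x hx
  · simp only [map_sub, map_sum, map_smul, sub_apply,
      sum_apply, smul_apply, smul_eq_mul]
    rw [h.symm _ (X x), h.pos_second hx, h.normal_pos x hx]
    simp only [h.symm _ (X x), h.pos_tangent' hx]
    have := h.sq x hx
    simp
    linear_combination (B (dd i X x) (dd j X x)) * this
  · simp only [map_sub, map_sum, map_smul, sub_apply,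
      sum_apply, smul_apply, smul_eq_mul]
    rw [h.symm _ (N x), h.normal_second hx, h.sq_normal x hx, h.symm _ (N x), h.normal_pos x hx]
    simp [h.symm _ (N x), h.normal _ x hx]
  · intro n
    simp only [map_sub, map_sum, map_smul, sub_apply,
      sum_apply, smul_apply, smul_eq_mul]
    rw [hΓ, h.pos_tangent' hx, h.normal _ x hx]
    simp

/-- The Gauss equation. -/
theorem gauss (h : IsLocalHypersurface B c U X N a) (hx : x ∈ U)
    (Γ : Fin m → Fin m → Fin m → Model m → ℝ) (hΓs : ∀ k i j, IsSmoothOn U (Γ k i j))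
    (hΓ : ∀ i j n, ∀ y ∈ U,
      ∑ k, Γ k i j y * B (dd k X y) (dd n X y) = B (dd i (dd j X) y) (dd n X y))
    (b : Fin m → Fin m → ℝ) (hb : ∀ i j, b i j = ∑ k, a k i x * B (dd k X x) (dd j X x))
    (i j k n : Fin m) :
    ∑ l, (dd i (Γ l j k) x - dd j (Γ l i k) x
        + ∑ s, (Γ l i s x * Γ s j k x - Γ l j s x * Γ s i k x)) * B (dd l X x) (dd n X x)
      = c * (B (dd j X x) (dd k X x) * B (dd i X x) (dd n X x)
          - B (dd i X x) (dd k X x) * B (dd j X x) (dd n X x)) - (b j k * b i n - b i k * b j n) := by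
  -- Differentiate the relation that defines Γ and solve for the term containing ∂_i Γ.
  have hd : ∀ i j k, ∑ l, dd i (Γ l j k) x * B (dd l X x) (dd n X x)
      = B (dd i (dd j (dd k X)) x) (dd n X x) + B (dd j (dd k X) x) (dd i (dd n X) x)
        - ∑ l, Γ l j k x * (B (dd i (dd l X) x) (dd n X x) + B (dd l X x) (dd i (dd n X) x)) := by
    intro i j k
    have h1 := dd_congr h.isOpen (fun y hy => hΓ j k n y hy) i x hx
    rw [dd_sum (fun l => (hΓs l j k).mul ((h.smooth.dd l).bilin B (h.smooth.dd n))) hx,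
      dd_bilin B ((h.smooth.dd k).dd j) (h.smooth.dd n) hx] at h1
    rw [← h1, ← Finset.sum_sub_distrib]
    refine Finset.sum_congr rfl fun l _ => ?_
    rw [dd_mul (hΓs l j k) ((h.smooth.dd l).bilin B (h.smooth.dd n)) hx,
      dd_bilin B (h.smooth.dd l) (h.smooth.dd n) hx]
    ring
  have hq : ∀ i j k, ∑ l, (∑ s, Γ l i s x * Γ s j k x) * B (dd l X x) (dd n X x)
      = ∑ l, Γ l j k x * B (dd i (dd l X) x) (dd n X x) := by
    intro i j k
    simp only [Finset.sum_mul]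
    rw [Finset.sum_comm]
    refine Finset.sum_congr rfl fun l _ => ?_
    rw [← hΓ i l n x hx, Finset.mul_sum]
    refine Finset.sum_congr rfl fun s _ => ?_
    ring
  -- The Gauss formula for ∂_j ∂_k X. Its X and N components produce the ambient curvature term and
  -- the quadratic term in `b`.
  have hB : ∀ i j k, B (dd j (dd k X) x) (dd i (dd n X) x)
      = ∑ l, Γ l j k x * B (dd l X x) (dd i (dd n X) x)
        + c * (B (dd j X x) (dd k X x) * B (dd i X x) (dd n X x)) - b j k * b i n := by
    intro i j k
    conv_lhs => rw [h.second_eq hx j k (fun l => Γ l j k x) (fun n => hΓ j k n x hx)]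
    simp only [map_sub, map_sum, map_smul, sub_apply,
      sum_apply, smul_apply, smul_eq_mul]
    rw [h.pos_second hx, h.normal_second hx, hb, hb]
    ring
  simp only [Finset.sum_sub_distrib, add_mul, sub_mul, Finset.sum_add_distrib]
  rw [hd i j k, hd j i k, hq i j k, hq j i k, hB i j k, hB j i k]
  -- Third derivatives of `X` are symmetric, so they cancel on antisymmetrizing in i and j.
  have hcomm : dd i (dd j (dd k X)) x = dd j (dd i (dd k X)) x := dd_comm (h.smooth.dd k) hx i j
  rw [hcomm]
  simp only [mul_add, Finset.sum_add_distrib]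
  ring

/-- The Codazzi equation. -/
theorem codazzi (h : IsLocalHypersurface B c U X N a) (hx : x ∈ U) (j k : Fin m) :
    ∑ i, (dd k (a i j) x • dd i X x + a i j x • dd k (dd i X) x)
      = ∑ i, (dd j (a i k) x • dd i X x + a i k x • dd j (dd i X) x) := by
  have key : ∀ j k, dd k (dd j N) x
      = -∑ i, (dd k (a i j) x • dd i X x + a i j x • dd k (dd i X) x) := by
    intro j k
    rw [dd_congr h.isOpen (h.weingarten j) k x hx, dd_neg,
      dd_sum (fun i => (h.smooth_shape i j).smul (h.smooth.dd i)) hx]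
    congr 1
    exact Finset.sum_congr rfl fun i _ => dd_smul (h.smooth_shape i j) (h.smooth.dd i) hx k
  have := dd_comm h.smooth_normal hx k j
  rw [key j k, key k j] at this
  exact neg_injective this

end IsLocalHypersurface

end LocalHypersurface

/-! ### Simons' formula and the Bochner type inequality at a point. -/

section Bochner

variable {m : ℕ} {V : Type*} [NormedAddCommGroup V] [NormedSpace ℝ V]
  {B : V →L[ℝ] V →L[ℝ] ℝ} {c : ℝ} {U : Set (Model m)} {X N : Model m → V}
  {a : Fin m → Fin m → Model m → ℝ} {x : Model m} {lam : Fin m → ℝ}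

namespace IsLocalHypersurface

/-- At a point where the coordinate frame is orthonormal and principal, and the Christoffel symbols
vanish, the second derivatives of the immersion are normal. -/
theorem second_inner_second (h : IsLocalHypersurface B c U X N a) (hx : x ∈ U)
    (hg : ∀ i j, B (dd i X x) (dd j X x) = if i = j then 1 else 0)
    (hΓ : ∀ i j k, B (dd i (dd j X) x) (dd k X x) = 0)
    (ha : ∀ i j, a i j x = if i = j then lam i else 0) (i j k l : Fin m) :
    B (dd i (dd j X) x) (dd k (dd l X) x)
      = if i = j ∧ k = l then c - lam i * lam k else 0 := by
  rw [h.second_eq hx i j 0 (fun n => by simp [hΓ])]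
  simp only [map_sub, map_sum, map_smul, sub_apply, sum_apply, smul_apply, smul_eq_mul]
  rw [h.pos_second hx, h.normal_second hx]
  simp only [hg, ha]
  by_cases hij : i = j <;> by_cases hkl : k = l <;> simp [hij, hkl] <;> intros <;>
    simp_all

/-- Pairing Codazzi with ∂_n X removes the second derivatives of `X`, which have no tangential part
at `x`. -/
theorem dd_shape_codazzi (h : IsLocalHypersurface B c U X N a) (hx : x ∈ U)
    (hg : ∀ i j, B (dd i X x) (dd j X x) = if i = j then 1 else 0)
    (hΓ : ∀ i j k, B (dd i (dd j X) x) (dd k X x) = 0) (n j k : Fin m) :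
    dd k (a n j) x = dd j (a n k) x := by
  have h1 := congrArg (fun v => B v (dd n X x)) (h.codazzi hx j k)
  simpa [hg, hΓ] using h1

theorem dd_metric (h : IsLocalHypersurface B c U X N a) (hx : x ∈ U)
    (hΓ : ∀ i j k, B (dd i (dd j X) x) (dd k X x) = 0) (i j k : Fin m) :
    dd k (fun y => B (dd i X y) (dd j X y)) x = 0 := by
  rw [dd_bilin B (h.smooth.dd i) (h.smooth.dd j) hx, hΓ, h.symm, hΓ, add_zero]

/-- The shape matrix with an index lowered is symmetric near `x`, and the first derivatives of the
metric vanish at `x`. -/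
theorem dd_shape_symm (h : IsLocalHypersurface B c U X N a) (hx : x ∈ U)
    (hg : ∀ i j, B (dd i X x) (dd j X x) = if i = j then 1 else 0)
    (hΓ : ∀ i j k, B (dd i (dd j X) x) (dd k X x) = 0) (n j k : Fin m) :
    dd k (a n j) x = dd k (a j n) x := by
  have hs : ∀ i j, IsSmoothOn U (fun y => B (dd i X y) (dd j X y)) := fun i j =>
    (h.smooth.dd i).bilin B (h.smooth.dd j)
  have key : ∀ n j, dd k (fun y => ∑ i, a i j y * B (dd i X y) (dd n X y)) x = dd k (a n j) x := by
    intro n j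
    rw [dd_sum (fun i => (h.smooth_shape i j).mul (hs i n)) hx]
    simp_rw [fun i => dd_mul (h.smooth_shape i j) (hs i n) hx k, h.dd_metric hx hΓ, hg]
    simp
  rw [← key n j, ← key j n]
  exact dd_congr h.isOpen (fun y hy => h.shape_symm hy j n) k x hx

/-- Codazzi differentiated once more and paired with ∂_n X. Third derivatives of `X` do have
tangential parts, which survive with the principal curvatures as weights. -/
theorem dd_dd_shape_codazzi (h : IsLocalHypersurface B c U X N a) (hx : x ∈ U)
    (hg : ∀ i j, B (dd i X x) (dd j X x) = if i = j then 1 else 0)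
    (hΓ : ∀ i j k, B (dd i (dd j X) x) (dd k X x) = 0)
    (ha : ∀ i j, a i j x = if i = j then lam i else 0) (n j k l : Fin m) :
    dd l (dd k (a n j)) x + lam j * B (dd l (dd k (dd j X)) x) (dd n X x)
      = dd l (dd j (a n k)) x + lam k * B (dd l (dd j (dd k X)) x) (dd n X x) := by
  have key : ∀ j k, B (dd l (fun y => ∑ i, (dd k (a i j) y • dd i X y
        + a i j y • dd k (dd i X) y)) x) (dd n X x)
      = dd l (dd k (a n j)) x + lam j * B (dd l (dd k (dd j X)) x) (dd n X x) := by
    intro j k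
    have s1 : ∀ i, IsSmoothOn U (fun y => dd k (a i j) y • dd i X y) := fun i =>
      ((h.smooth_shape i j).dd k).smul (h.smooth.dd i)
    have s2 : ∀ i, IsSmoothOn U (fun y => a i j y • dd k (dd i X) y) := fun i =>
      (h.smooth_shape i j).smul ((h.smooth.dd i).dd k)
    rw [dd_sum (fun i => fun y hy => (s1 i y hy).add (s2 i y hy)) hx]
    simp_rw [fun i => dd_add (s1 i) (s2 i) hx l,
      fun i => dd_smul ((h.smooth_shape i j).dd k) (h.smooth.dd i) hx l,
      fun i => dd_smul (h.smooth_shape i j) ((h.smooth.dd i).dd k) hx l]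
    simp [hg, hΓ, ha, Finset.sum_add_distrib]
  rw [← key j k, ← key k j, dd_congr h.isOpen (fun y hy => h.codazzi hy j k) l x hx]

/-- Second derivative of the symmetry of the lowered shape matrix. The second derivatives of the
metric remain as correction terms. -/
theorem dd_dd_shape_symm (h : IsLocalHypersurface B c U X N a) (hx : x ∈ U)
    (hg : ∀ i j, B (dd i X x) (dd j X x) = if i = j then 1 else 0)
    (hΓ : ∀ i j k, B (dd i (dd j X) x) (dd k X x) = 0)
    (ha : ∀ i j, a i j x = if i = j then lam i else 0) (n j k l : Fin m) :
    dd l (dd k (a n j)) x + lam j * dd l (dd k (fun y => B (dd j X y) (dd n X y))) x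
      = dd l (dd k (a j n)) x + lam n * dd l (dd k (fun y => B (dd n X y) (dd j X y))) x := by
  have hs : ∀ i j, IsSmoothOn U (fun y => B (dd i X y) (dd j X y)) := fun i j =>
    (h.smooth.dd i).bilin B (h.smooth.dd j)
  have key : ∀ n j, dd l (dd k (fun y => ∑ i, a i j y * B (dd i X y) (dd n X y))) x
      = dd l (dd k (a n j)) x + lam j * dd l (dd k (fun y => B (dd j X y) (dd n X y))) x := by
    intro n j
    rw [dd_dd_sum h.isOpen (fun i => (h.smooth_shape i j).mul (hs i n)) hx]
    simp_rw [fun i => dd_dd_mul h.isOpen (h.smooth_shape i j) (hs i n) hx l k,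
      h.dd_metric hx hΓ, hg, ha]
    simp [Finset.sum_add_distrib]
  rw [← key n j, ← key j n]
  exact dd_congr h.isOpen (fun y hy => dd_congr h.isOpen
    (fun z hz => h.shape_symm hz j n) k y hy) l x hx

/-- The Ricci identity for A: pass from a_ii,ll to a_ll,ii by Codazzi, an exchange of derivatives,
symmetry, and Codazzi again. The accumulated corrections amount to the sectional curvature c - λ_i
λ_l times λ_i - λ_l. -/
theorem dd_dd_shape_comm (h : IsLocalHypersurface B c U X N a) (hx : x ∈ U)
    (hg : ∀ i j, B (dd i X x) (dd j X x) = if i = j then 1 else 0)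
    (hΓ : ∀ i j k, B (dd i (dd j X) x) (dd k X x) = 0)
    (ha : ∀ i j, a i j x = if i = j then lam i else 0) (i l : Fin m) :
    dd l (dd l (a i i)) x = dd i (dd i (a l l)) x + (lam i - lam l) * (c - lam i * lam l) := by
  rcases eq_or_ne i l with rfl | hil
  · simp
  have e1 := h.dd_dd_shape_codazzi hx hg hΓ ha i i l l
  have e2 : dd l (dd i (a i l)) x = dd i (dd l (a i l)) x := dd_comm (h.smooth_shape i l) hx l i
  have e3 := h.dd_dd_shape_symm hx hg hΓ ha i l l i
  have e4 := h.dd_dd_shape_codazzi hx hg hΓ ha l i l i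
  have e5 : dd i (dd l (fun y => B (dd l X y) (dd i X y))) x
      = dd i (dd l (fun y => B (dd i X y) (dd l X y))) x := by
    simp only [h.symm (dd l X _)]
  -- Curvature enters here: this second derivative of g_il contains ⟨∂_i ∂_i X, ∂_l ∂_l X⟩ = c - λ_i
  -- λ_l, while its mixed term ⟨∂_l ∂_i X, ∂_i ∂_l X⟩ is zero.
  have e6 := dd_dd_bilin B h.isOpen (h.smooth.dd i) (h.smooth.dd l) hx i l
  have e7 := h.second_inner_second hx hg hΓ ha
  have c1 : dd i (dd l (dd i X)) x = dd i (dd i (dd l X)) x :=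
    dd_congr h.isOpen (fun y hy => dd_comm h.smooth hy l i) i x hx
  have c2 : dd i (dd l (dd l X)) x = dd l (dd i (dd l X)) x := dd_comm (h.smooth.dd l) hx i l
  have c3 : dd l (dd i (dd l X)) x = dd l (dd l (dd i X)) x :=
    dd_congr h.isOpen (fun y hy => dd_comm h.smooth hy i l) l x hx
  rw [e7, e7, h.symm (dd i X x)] at e6
  simp only [hil, hil.symm, and_self, if_true, if_false] at e6
  rw [c2, c3, c1] at e6
  rw [c1] at e4
  rw [c3] at e1
  rw [e5, e6] at e3
  linear_combination e1 + e2 + e3 + e4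

variable {K : ℝ}

/-- The Bochner type inequality at the core of the argument: in coordinates that are normal and
principal at `x`, the trace `H` of the shape operator satisfies
`(3/2) H ΔH + (5/2) |∇H|² ≥ 0`. -/
theorem bochner_inequality (h : IsLocalHypersurface B c U X N a) (hx : x ∈ U)
    (hg : ∀ i j, B (dd i X x) (dd j X x) = if i = j then 1 else 0)
    (hΓ : ∀ i j k, B (dd i (dd j X) x) (dd k X x) = 0)
    (ha : ∀ i j, a i j x = if i = j then lam i else 0)
    {H : Model m → ℝ} (hH : ∀ y ∈ U, H y = ∑ i, a i i y)
    (hK : ∀ y ∈ U, ∑ i, ∑ j, a i j y * a j i y = H y * H y + K)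
    (hbic : ∀ y ∈ U, ∀ j, ∑ k, a k j y * dd k H y = -(1 / 2) * (H y * dd j H y))
    (hsec : ∀ i l, i ≠ l → 0 ≤ c - lam i * lam l) :
    0 ≤ 3 / 2 * (H x * ∑ l, dd l (dd l H) x) + 5 / 2 * ∑ l, dd l H x ^ 2 := by
  have hHs : IsSmoothOn U H := fun y hy =>
    ((IsSmoothOn.sum fun i => h.smooth_shape i i) y hy).congr_of_eventuallyEq
      (by filter_upwards [h.isOpen.mem_nhds hy] with z hz using hH z hz)
  have hH1 : ∀ k, dd k H x = ∑ i, dd k (a i i) x := fun k => by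
    rw [dd_congr h.isOpen hH k x hx, dd_sum (fun i => h.smooth_shape i i) hx]
  have hH2 : ∀ k, dd k (dd k H) x = ∑ i, dd k (dd k (a i i)) x := fun k => by
    rw [dd_congr h.isOpen (fun y hy => dd_congr h.isOpen hH k y hy) k x hx,
      dd_dd_sum h.isOpen (fun i => h.smooth_shape i i) hx]
  -- the Laplacian of the squared norm
  have eK : ∀ l, ∑ i, lam i * dd l (dd l (a i i)) x + ∑ i, ∑ j, dd l (a i j) x ^ 2
      = dd l H x ^ 2 + H x * dd l (dd l H) x := by
    intro l
    have h1 := dd_congr h.isOpen (fun y hy => dd_congr h.isOpen hK l y hy) l x hx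
    have hs : ∀ i j, IsSmoothOn U (fun y => a i j y * a j i y) := fun i j =>
      (h.smooth_shape i j).mul (h.smooth_shape j i)
    rw [dd_dd_sum h.isOpen (fun i => IsSmoothOn.sum (hs i)) hx] at h1
    simp_rw [fun i => dd_dd_sum h.isOpen (hs i) hx l l,
      fun i j => dd_dd_mul h.isOpen (h.smooth_shape i j) (h.smooth_shape j i) hx l l,
      fun i j => h.dd_shape_symm hx hg hΓ j i l, ha] at h1
    have h2 : dd l (dd l (fun y => H y * H y + K)) x
        = 2 * (dd l H x ^ 2 + H x * dd l (dd l H) x) := by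
      rw [dd_congr h.isOpen (fun y hy => (dd_add (hHs.mul hHs)
        (G := fun _ => K) (fun z _ => contDiffAt_const) hy l).trans
        (by rw [dd_const, add_zero])) l x hx, dd_dd_mul h.isOpen hHs hHs hx]
      ring
    rw [h2] at h1
    have h3 : ∀ i, ∑ j, (dd l (dd l (a i j)) x * (if j = i then lam j else 0)
        + dd l (a i j) x * dd l (a i j) x + (dd l (a i j) x * dd l (a i j) x
        + (if i = j then lam i else 0) * dd l (dd l (a j i)) x))
        = 2 * (lam i * dd l (dd l (a i i)) x + ∑ j, dd l (a i j) x ^ 2) := by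
      intro i
      simp only [Finset.sum_add_distrib, mul_ite, mul_zero, ite_mul, zero_mul,
        Finset.sum_ite_eq, Finset.sum_ite_eq', Finset.mem_univ, if_true, ← pow_two]
      ring
    simp_rw [h3, ← Finset.mul_sum, Finset.sum_add_distrib] at h1
    linarith
  -- the divergence of the biconservative equation
  have eB : ∑ j, dd j H x ^ 2 + ∑ j, lam j * dd j (dd j H) x
      = -(1 / 2) * (∑ j, dd j H x ^ 2 + H x * ∑ j, dd j (dd j H) x) := by
    have h1 : ∀ j, ∑ k, dd j (a k j) x * dd k H x + lam j * dd j (dd j H) x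
        = -(1 / 2) * (dd j H x ^ 2 + H x * dd j (dd j H) x) := by
      intro j
      have h2 := dd_congr h.isOpen (fun y hy => hbic y hy j) j x hx
      rw [dd_sum (fun k => (h.smooth_shape k j).mul (hHs.dd k)) hx,
        dd_mul (f := fun _ => -(1 / 2 : ℝ)) (fun z _ => contDiffAt_const) (hHs.mul (hHs.dd j)) hx,
        dd_const, dd_mul hHs (hHs.dd j) hx] at h2
      simp_rw [fun k => dd_mul (h.smooth_shape k j) (hHs.dd k) hx j, ha] at h2
      simp only [Finset.sum_add_distrib, ite_mul, zero_mul, Finset.sum_ite_eq', Finset.mem_univ,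
        if_true] at h2
      linarith
    have h2 := Finset.sum_congr rfl fun j (_ : j ∈ Finset.univ) => h1 j
    rw [Finset.sum_add_distrib, ← Finset.mul_sum, Finset.sum_add_distrib, ← Finset.mul_sum] at h2
    rw [← h2, Finset.sum_comm]
    congr 1
    refine Finset.sum_congr rfl fun k _ => ?_
    rw [← Finset.sum_mul, pow_two]
    congr 1
    rw [hH1]
    -- The divergence of A equals dH, by symmetry and Codazzi.
    refine Finset.sum_congr rfl fun j _ => ?_
    rw [h.dd_shape_symm hx hg hΓ k j j, h.dd_shape_codazzi hx hg hΓ j k j]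
  -- commutation of second derivatives
  have eC : ∑ l, ∑ i, lam i * dd l (dd l (a i i)) x
      = ∑ i, lam i * dd i (dd i H) x
        + ∑ i, ∑ l, lam i * ((lam i - lam l) * (c - lam i * lam l)) := by
    rw [Finset.sum_comm, ← Finset.sum_add_distrib]
    refine Finset.sum_congr rfl fun i _ => ?_
    rw [hH2, Finset.mul_sum, ← Finset.sum_add_distrib]
    refine Finset.sum_congr rfl fun l _ => ?_
    rw [h.dd_dd_shape_comm hx hg hΓ ha i l]
    ring
  -- Symmetrizing in i and l turns the sum into ½ Σ (λ_i - λ_l)² (c - λ_i λ_l).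
  have hcurv : 0 ≤ ∑ i, ∑ l, lam i * ((lam i - lam l) * (c - lam i * lam l)) := by
    have h1 : 2 * ∑ i, ∑ l, lam i * ((lam i - lam l) * (c - lam i * lam l))
        = ∑ i, ∑ l, (lam i - lam l) ^ 2 * (c - lam i * lam l) := by
      rw [two_mul]
      nth_rewrite 2 [Finset.sum_comm]
      simp_rw [← Finset.sum_add_distrib]
      refine Finset.sum_congr rfl fun i _ => Finset.sum_congr rfl fun l _ => ?_
      ring
    have h2 : 0 ≤ ∑ i, ∑ l, (lam i - lam l) ^ 2 * (c - lam i * lam l) := by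
      refine Finset.sum_nonneg fun i _ => Finset.sum_nonneg fun l _ => ?_
      rcases eq_or_ne i l with rfl | hil
      · simp
      · exact mul_nonneg (sq_nonneg _) (hsec i l hil)
    linarith
  have hsq : 0 ≤ ∑ l, ∑ i, ∑ j, dd l (a i j) x ^ 2 :=
    Finset.sum_nonneg fun l _ => Finset.sum_nonneg fun i _ => Finset.sum_nonneg fun j _ =>
      sq_nonneg _
  -- Summing over l gives Simons' formula; the sum of λ_i ∂_i ∂_i H is then eliminated with `eB`,
  -- and |∇A|² and the curvature term are discarded.
  have eS := Finset.sum_congr rfl fun l (_ : l ∈ Finset.univ) => eK l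
  rw [Finset.sum_add_distrib, Finset.sum_add_distrib, ← Finset.mul_sum, eC] at eS
  linarith

/-- The Bochner inequality gives HΔH ≥ -(5/3)|∇H|², so ΔH^p ≥ 0 for even p with p - 1 ≥ 5/3. The
least such p is 4; the square of H would not do. -/
theorem laplacian_pow_four_nonneg (h : IsLocalHypersurface B c U X N a) (hx : x ∈ U)
    (hg : ∀ i j, B (dd i X x) (dd j X x) = if i = j then 1 else 0)
    (hΓ : ∀ i j k, B (dd i (dd j X) x) (dd k X x) = 0)
    (ha : ∀ i j, a i j x = if i = j then lam i else 0)
    {H : Model m → ℝ} (hH : ∀ y ∈ U, H y = ∑ i, a i i y)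
    (hK : ∀ y ∈ U, ∑ i, ∑ j, a i j y * a j i y = H y * H y + K)
    (hbic : ∀ y ∈ U, ∀ j, ∑ k, a k j y * dd k H y = -(1 / 2) * (H y * dd j H y))
    (hsec : ∀ i l, i ≠ l → 0 ≤ c - lam i * lam l) :
    0 ≤ ∑ l, dd l (dd l (fun y => H y ^ 4)) x := by
  have hHs : IsSmoothOn U H := fun y hy =>
    ((IsSmoothOn.sum fun i => h.smooth_shape i i) y hy).congr_of_eventuallyEq
      (by filter_upwards [h.isOpen.mem_nhds hy] with z hz using hH z hz)
  have h1 := h.bochner_inequality hx hg hΓ ha hH hK hbic hsec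
  have h2 : ∀ l, dd l (dd l (fun y => H y ^ 4)) x
      = 4 * H x ^ 2 * (H x * dd l (dd l H) x + 3 * dd l H x ^ 2) := by
    intro l
    have e : (fun y => H y ^ 4) = fun y => (H y * H y) * (H y * H y) := by
      funext y; ring
    rw [e, dd_dd_mul h.isOpen (hHs.mul hHs) (hHs.mul hHs) hx, dd_dd_mul h.isOpen hHs hHs hx,
      dd_mul hHs hHs hx]
    ring
  simp_rw [h2]
  rw [← Finset.mul_sum, Finset.sum_add_distrib, ← Finset.mul_sum, ← Finset.mul_sum]
  have h3 : 0 ≤ ∑ l, dd l H x ^ 2 := Finset.sum_nonneg fun l _ => sq_nonneg _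
  exact mul_nonneg (by positivity) (by linarith)

end IsLocalHypersurface

end Bochner

/-! ### Linear algebra of the Lorentzian scalar product. -/

section Lorentz

variable {m : ℕ}

theorem lorentz_apply (v w : Ambient m) :
    lorentz m v w = -(v 0 * w 0) + ∑ i : Fin (m + 1), v i.succ * w i.succ := rfl

theorem lorentz_comm (v w : Ambient m) : lorentz m v w = lorentz m w v := by
  simp only [lorentz_apply, mul_comm]

theorem eq_zero_of_lorentz_eq_zero {v : Ambient m} (h : ∀ w, lorentz m v w = 0) : v = 0 := by
  ext j
  refine Fin.cases ?_ (fun i => ?_) j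
  · simpa [lorentz_apply] using h (EuclideanSpace.single 0 1)
  · have := h (EuclideanSpace.single i.succ 1)
    simpa [lorentz_apply, Fin.succ_ne_zero, (Fin.succ_ne_zero _).symm, Pi.single_apply] using this

/-- The Lorentzian scalar product as a continuous bilinear map. -/
def lorentzCLM (m : ℕ) : Ambient m →L[ℝ] Ambient m →L[ℝ] ℝ :=
  LinearMap.toContinuousLinearMap
    ((LinearMap.toContinuousLinearMap : (Ambient m →ₗ[ℝ] ℝ) ≃ₗ[ℝ] _).toLinearMap ∘ₗ lorentz m)

@[simp]
theorem lorentzCLM_apply (v w : Ambient m) : lorentzCLM m v w = lorentz m v w := rfl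

/-- A tangent space with positive definite form, its unit normal, and the position vector span the
ambient space. -/
theorem eq_zero_of_orthogonal {T : Type*} [AddCommGroup T] [Module ℝ T]
    [FiniteDimensional ℝ T] (hT : Module.finrank ℝ T = m) (D : T →ₗ[ℝ] Ambient m)
    (hD : ∀ v, v ≠ 0 → 0 < lorentz m (D v) (D v)) {x n : Ambient m}
    (hx : lorentz m x x ≠ 0) (hn : lorentz m n n ≠ 0) (hnx : lorentz m n x = 0)
    (hxD : ∀ v, lorentz m x (D v) = 0) (hnD : ∀ v, lorentz m n (D v) = 0)
    {z : Ambient m} (hzx : lorentz m z x = 0) (hzn : lorentz m z n = 0)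
    (hzD : ∀ v, lorentz m z (D v) = 0) : z = 0 := by
  let L : (ℝ × ℝ) × T →ₗ[ℝ] Ambient m :=
    ((LinearMap.toSpanSingleton ℝ _ x).coprod (LinearMap.toSpanSingleton ℝ _ n)).coprod D
  have hL : ∀ s t v, L ((s, t), v) = s • x + t • n + D v := fun s t v => by simp [L]
  have hinj : Function.Injective L := by
    rw [← LinearMap.ker_eq_bot, LinearMap.ker_eq_bot']
    rintro ⟨⟨s, t⟩, v⟩ h
    rw [hL] at h
    have h1 := congrArg (lorentz m x) h
    have h2 := congrArg (lorentz m n) h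
    simp only [map_add, map_smul, smul_eq_mul, hxD, hnD, hnx, lorentz_comm x n, map_zero, mul_zero,
      add_zero, zero_add, mul_eq_zero, hx, hn, or_false] at h1 h2
    subst h1 h2
    simp only [zero_smul, zero_add] at h
    have hv : v = 0 := by
      by_contra hv
      have := hD v hv
      simp [h] at this
    simp [hv]
  -- Dimension count: both sides have dimension m + 2.
  have hsurj : Function.Surjective L := by
    refine (LinearMap.injective_iff_surjective_of_finrank_eq_finrank ?_).1 hinj
    simp [hT]; ring
  apply eq_zero_of_lorentz_eq_zero
  intro w
  obtain ⟨⟨⟨s, t⟩, v⟩, rfl⟩ := hsurj w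
  rw [hL]
  simp [hzx, hzn, hzD]

end Lorentz

/-! ### Smoothness of inverse matrices. -/

section SmoothInverse

variable {m k : ℕ} {U : Set (Model m)} {A : Model m → Matrix (Fin k) (Fin k) ℝ}

theorem IsSmoothOn.det (h : ∀ i j, IsSmoothOn U (fun y => A y i j)) :
    IsSmoothOn U (fun y => (A y).det) := fun y hy => by
  simp only [Matrix.det_apply']
  exact ContDiffAt.sum fun σ _ => contDiffAt_const.mul
    (contDiffAt_prod fun i _ => h _ _ y hy)

/-- By Cramer's rule the entries are quotients of determinants, which are polynomials in the entries
of `A`. -/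
theorem IsSmoothOn.matrix_inv (h : ∀ i j, IsSmoothOn U (fun y => A y i j))
    (hdet : ∀ y ∈ U, (A y).det ≠ 0) (i j : Fin k) : IsSmoothOn U (fun y => (A y)⁻¹ i j) := by
  intro y hy
  simp only [Matrix.inv_def, Ring.inverse_eq_inv', Matrix.smul_apply, Matrix.adjugate_apply,
    smul_eq_mul]
  refine ((IsSmoothOn.det h y hy).inv (hdet y hy)).mul
    (IsSmoothOn.det (A := fun y => (A y).updateRow j (Pi.single i 1)) (fun k l => ?_) y hy)
  intro z hz
  simp only [Matrix.updateRow_apply]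
  split_ifs
  · exact contDiffAt_const
  · exact h k l z hz

end SmoothInverse

/-! ### Orthogonality relations and the Weingarten equation on the manifold. -/

section Parametrization

variable {m : ℕ} {M : Type*} [TopologicalSpace M] [ChartedSpace (Model m) M]
  {c : ℝ} {φ η : M → Ambient m}

theorem IsSpacelikeHypersurface.metric_nondegenerate (hφ : IsSpacelikeHypersurface c φ) (p : M) :
    (inducedMetric φ p).Nondegenerate := by
  have hsymm : ∀ v w, inducedMetric φ p v w = inducedMetric φ p w v := fun v w =>
    lorentz_comm _ _
  have hl : ∀ v, (∀ w, inducedMetric φ p v w = 0) → v = 0 := by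
    intro v hv
    by_contra h
    exact (hφ.spacelike p v h).ne' (hv v)
  exact ⟨hl, fun v hv => hl v fun w => by rw [hsymm]; exact hv w⟩

theorem IsSpacelikeHypersurface.metric_sharp (hφ : IsSpacelikeHypersurface c φ) (p : M)
    (α : Module.Dual ℝ (TangentSpace 𝓘(ℝ, Model m) p)) (v : TangentSpace 𝓘(ℝ, Model m) p) :
    inducedMetric φ p (sharp (inducedMetric φ) p α) v = α v := by
  rw [sharp, dif_pos (hφ.metric_nondegenerate p)]
  exact LinearMap.BilinForm.apply_toDual_symm_apply (hB := hφ.metric_nondegenerate p) α v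

theorem dd_comp {V : M → Ambient m} (hV : ContMDiff 𝓘(ℝ, Model m) 𝓘(ℝ, Ambient m) ∞ V)
    {f : Model m → M} {y : Model m} (hf : ContMDiffAt 𝓘(ℝ, Model m) 𝓘(ℝ, Model m) ∞ f y)
    (i : Fin m) : dd i (V ∘ f) y = differential V (f y)
      (mfderiv 𝓘(ℝ, Model m) 𝓘(ℝ, Model m) f y (EuclideanSpace.single i (1 : ℝ))) := by
  have h := mfderiv_comp y ((hV (f y)).mdifferentiableAt (by simp)) (hf.mdifferentiableAt (by simp))
  rw [mfderiv_eq_fderiv] at h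
  unfold dd
  rw [h]
  rfl

/-- The matrix `⟨∂_i X, ∂_j X⟩` of a map `X`. -/
def gram (X : Model m → Ambient m) (y : Model m) : Matrix (Fin m) (Fin m) ℝ :=
  Matrix.of fun i j => lorentz m (dd i X y) (dd j X y)

/-- The matrix of the shape operator in the coordinate frame, for a parametrized hypersurface. -/
def shapeMatrix (X N : Model m → Ambient m) (y : Model m) : Matrix (Fin m) (Fin m) ℝ :=
  (gram X y)⁻¹ * Matrix.of fun i j => -lorentz m (dd j N y) (dd i X y)

/-- `f` is a smooth immersion of the open set `U` into `M`. -/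
structure IsParametrization (U : Set (Model m)) (f : Model m → M) : Prop where
  isOpen : IsOpen U
  smooth : ∀ y ∈ U, ContMDiffAt 𝓘(ℝ, Model m) 𝓘(ℝ, Model m) ∞ f y
  injective : ∀ y ∈ U, Function.Injective (mfderiv 𝓘(ℝ, Model m) 𝓘(ℝ, Model m) f y)

variable {U : Set (Model m)} {f : Model m → M} {y : Model m}

theorem IsSpacelikeHypersurface.lorentz_self (hφ : IsSpacelikeHypersurface c φ) (p : M) :
    lorentz m (φ p) (φ p) = 1 / c := hφ.mem_deSitterSpace p

/-- The product rule for a constant scalar product. Applied to the pairs (φ, φ), (η, η) and (η, φ),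
it shows that dφ is orthogonal to φ and dη to both η and φ. -/
theorem lorentz_differential_of_eq_const {V W : M → Ambient m} {k : ℝ}
    (hV : ContMDiff 𝓘(ℝ, Model m) 𝓘(ℝ, Ambient m) ∞ V)
    (hW : ContMDiff 𝓘(ℝ, Model m) 𝓘(ℝ, Ambient m) ∞ W) (h : ∀ q, lorentz m (V q) (W q) = k)
    (p : M) (v : TangentSpace 𝓘(ℝ, Model m) p) :
    lorentz m (V p) (differential W p v) + lorentz m (differential V p v) (W p) = 0 := by
  have hq : HasFDerivAt (fun z : Ambient m × Ambient m => lorentzCLM m z.1 z.2)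
      ((lorentzCLM m (V p)).comp (ContinuousLinearMap.snd ℝ _ _)
        + ((lorentzCLM m).flip (W p)).comp (ContinuousLinearMap.fst ℝ _ _)) (V p, W p) := by
    refine ((lorentzCLM m).hasFDerivAt_of_bilinear (hasFDerivAt_fst (p := (V p, W p)))
      (hasFDerivAt_snd (p := (V p, W p)))).congr_fderiv ?_
    ext w <;> simp
  have hV' := ((hV p).mdifferentiableAt (by simp)).hasMFDerivAt
  have hW' := ((hW p).mdifferentiableAt (by simp)).hasMFDerivAt
  have h0 : HasMFDerivAt 𝓘(ℝ, Model m) 𝓘(ℝ, Ambient m × Ambient m) (fun q => (V q, W q)) p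
      ((mfderiv 𝓘(ℝ, Model m) 𝓘(ℝ, Ambient m) V p).prod
        (mfderiv 𝓘(ℝ, Model m) 𝓘(ℝ, Ambient m) W p)) :=
    ⟨hV'.1.prodMk hW'.1, hV'.2.prodMk hW'.2⟩
  have h1 := HasMFDerivAt.comp (g := fun z : Ambient m × Ambient m => lorentzCLM m z.1 z.2) p
    hq.hasMFDerivAt h0
  have h2 : (fun z : Ambient m × Ambient m => lorentzCLM m z.1 z.2) ∘ (fun q => (V q, W q))
      = fun _ => k := funext h
  rw [h2] at h1
  exact congrArg (fun L => L v) (hasMFDerivAt_unique h1 (hasMFDerivAt_const k p))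

theorem lorentz_differential_self (hφ : IsSpacelikeHypersurface c φ) (p : M)
    (v : TangentSpace 𝓘(ℝ, Model m) p) : lorentz m (φ p) (differential φ p v) = 0 := by
  have h := lorentz_differential_of_eq_const hφ.smooth hφ.smooth hφ.lorentz_self p v
  rw [lorentz_comm (differential φ p v)] at h
  linarith

theorem lorentz_normal_differential (hη : IsUnitNormalField φ η) (p : M)
    (v : TangentSpace 𝓘(ℝ, Model m) p) : lorentz m (η p) (differential η p v) = 0 := by
  have h := lorentz_differential_of_eq_const hη.smooth hη.smooth hη.unit p v
  rw [lorentz_comm (differential η p v)] at h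
  linarith

theorem lorentz_position_differential_normal (hφ : IsSpacelikeHypersurface c φ)
    (hη : IsUnitNormalField φ η) (p : M)
    (v : TangentSpace 𝓘(ℝ, Model m) p) : lorentz m (φ p) (differential η p v) = 0 := by
  have h := lorentz_differential_of_eq_const hη.smooth hφ.smooth hη.tangent p v
  rwa [hη.normal, zero_add, lorentz_comm] at h

theorem finrank_tangentSpace (p : M) :
    Module.finrank ℝ (TangentSpace 𝓘(ℝ, Model m) p) = m :=
  finrank_euclideanSpace_fin (𝕜 := ℝ) (n := m)

theorem eq_zero_of_orthogonal_hypersurface (hc : 0 < c) (hφ : IsSpacelikeHypersurface c φ)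
    (hη : IsUnitNormalField φ η) (p : M) {z : Ambient m} (hzx : lorentz m z (φ p) = 0)
    (hzn : lorentz m z (η p) = 0) (hzD : ∀ v, lorentz m z (differential φ p v) = 0) : z = 0 := by
  refine eq_zero_of_orthogonal (finrank_tangentSpace p) (differential φ p)
    (fun v hv => hφ.spacelike p v hv) (x := φ p) (n := η p) ?_ ?_ (hη.tangent p)
    (lorentz_differential_self hφ p) (hη.normal p) hzx hzn hzD
  · rw [hφ.lorentz_self]; positivity
  · rw [hη.unit]; norm_num

/-- The correction in the de Sitter connection is a multiple of φ, hence orthogonal to the image of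
dφ, so the flat derivative of η may be used instead. -/
theorem metric_shapeOperator (hφ : IsSpacelikeHypersurface c φ) (p : M)
    (v w : TangentSpace 𝓘(ℝ, Model m) p) :
    inducedMetric φ p (shapeOperator c φ η p v) w
      = -lorentz m (differential η p v) (differential φ p w) := by
  rw [shapeOperator, LinearMap.comp_apply, hφ.metric_sharp]
  simp [secondForm, deSitterConnection, lorentz_differential_self hφ]

/-- The Weingarten equation in the ambient space. -/
theorem differential_normal (hc : 0 < c) (hφ : IsSpacelikeHypersurface c φ)
    (hη : IsUnitNormalField φ η) (p : M) (v : TangentSpace 𝓘(ℝ, Model m) p) :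
    differential η p v = -differential φ p (shapeOperator c φ η p v) := by
  rw [← sub_eq_zero, sub_neg_eq_add]
  apply eq_zero_of_orthogonal_hypersurface hc hφ hη p
  · rw [map_add, LinearMap.add_apply, lorentz_comm, lorentz_position_differential_normal hφ hη,
      lorentz_comm, lorentz_differential_self hφ, add_zero]
  · rw [map_add, LinearMap.add_apply, lorentz_comm, lorentz_normal_differential hη,
      lorentz_comm, hη.normal, add_zero]
  · intro w
    rw [map_add, LinearMap.add_apply]
    have := metric_shapeOperator (η := η) hφ p v w
    rw [show inducedMetric φ p (shapeOperator c φ η p v) w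
      = lorentz m (differential φ p (shapeOperator c φ η p v)) (differential φ p w) from rfl] at this
    linarith

end Parametrization

/-! ### The shape operator in coordinates. -/

section ShapeOperator

variable {m : ℕ} {M : Type*} [TopologicalSpace M] [ChartedSpace (Model m) M]
  {c : ℝ} {φ η : M → Ambient m} {U : Set (Model m)} {f : Model m → M} {y : Model m}

/-- The standard basis of the model space. -/
def stdBasis (m : ℕ) : Module.Basis (Fin m) ℝ (Model m) := (EuclideanSpace.basisFun (Fin m) ℝ).toBasis

theorem stdBasis_apply (i : Fin m) : stdBasis m i = EuclideanSpace.single i (1 : ℝ) := by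
  simp [stdBasis]

/-- The differential of a parametrization, as a linear isomorphism. -/
def IsParametrization.equiv (hf : IsParametrization U f) (hy : y ∈ U) :
    Model m ≃ₗ[ℝ] TangentSpace 𝓘(ℝ, Model m) (f y) :=
  LinearEquiv.ofBijective (mfderiv 𝓘(ℝ, Model m) 𝓘(ℝ, Model m) f y).toLinearMap
    ⟨hf.injective y hy, (LinearMap.injective_iff_surjective_of_finrank_eq_finrank
      ((finrank_tangentSpace y).trans (finrank_tangentSpace (f y)).symm)).1 (hf.injective y hy)⟩

theorem IsParametrization.dd_comp (hf : IsParametrization U f) (hy : y ∈ U) {V : M → Ambient m}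
    (hV : ContMDiff 𝓘(ℝ, Model m) 𝓘(ℝ, Ambient m) ∞ V) (i : Fin m) :
    dd i (V ∘ f) y = differential V (f y) (hf.equiv hy (stdBasis m i)) := by
  rw [DeSitter.dd_comp hV (hf.smooth y hy), stdBasis_apply]
  rfl

theorem IsParametrization.isSmoothOn_comp (hf : IsParametrization U f) {V : M → Ambient m}
    (hV : ContMDiff 𝓘(ℝ, Model m) 𝓘(ℝ, Ambient m) ∞ V) : IsSmoothOn U (V ∘ f) := fun z hz =>
  contMDiffAt_iff_contDiffAt.1 ((hV (f z)).comp z (hf.smooth z hz))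

theorem gram_symm (X : Model m → Ambient m) (y : Model m) (i j : Fin m) :
    gram X y i j = gram X y j i := lorentz_comm _ _

theorem IsParametrization.gram_apply (hf : IsParametrization U f) (hy : y ∈ U)
    (hφ : IsSpacelikeHypersurface c φ) (i j : Fin m) :
    gram (φ ∘ f) y i j = inducedMetric φ (f y) (hf.equiv hy (stdBasis m i))
      (hf.equiv hy (stdBasis m j)) := by
  simp only [gram, Matrix.of_apply, hf.dd_comp hy hφ.smooth]
  rfl

theorem IsParametrization.gram_posDef (hf : IsParametrization U f) (hy : y ∈ U)
    (hφ : IsSpacelikeHypersurface c φ) : (gram (φ ∘ f) y).PosDef := by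
  refine Matrix.PosDef.of_dotProduct_mulVec_pos ?_ fun t ht => ?_
  · ext i j
    simp [gram_symm _ _ j i]
  · have h1 : star t ⬝ᵥ (gram (φ ∘ f) y).mulVec t
        = inducedMetric φ (f y) (hf.equiv hy (∑ i, t i • stdBasis m i))
            (hf.equiv hy (∑ i, t i • stdBasis m i)) := by
      simp only [dotProduct, Matrix.mulVec, hf.gram_apply hy hφ, map_sum, map_smul,
        LinearMap.sum_apply, LinearMap.smul_apply, smul_eq_mul, Finset.mul_sum, Pi.star_apply,
        star_trivial]
      rw [Finset.sum_comm]
      refine Finset.sum_congr rfl fun i _ => Finset.sum_congr rfl fun j _ => ?_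
      ring
    rw [h1]
    apply hφ.spacelike
    rw [Ne, LinearEquiv.map_eq_zero_iff]
    intro h0
    apply ht
    funext i
    exact Fintype.linearIndependent_iff.1 (stdBasis m).linearIndependent t h0 i

theorem IsParametrization.gram_det_ne_zero (hf : IsParametrization U f) (hy : y ∈ U)
    (hφ : IsSpacelikeHypersurface c φ) : (gram (φ ∘ f) y).det ≠ 0 :=
  (hf.gram_posDef hy hφ).det_pos.ne'

theorem IsParametrization.shapeOperator_apply (hf : IsParametrization U f) (hy : y ∈ U)
    (j : Fin m) : shapeOperator c φ η (f y) (hf.equiv hy (stdBasis m j))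
      = ∑ i, LinearMap.toMatrix (stdBasis m) (stdBasis m)
          ((hf.equiv hy).symm.conj (shapeOperator c φ η (f y))) i j
            • hf.equiv hy (stdBasis m i) := by
  have h := (stdBasis m).sum_repr
    ((hf.equiv hy).symm.conj (shapeOperator c φ η (f y)) (stdBasis m j))
  have h2 := congrArg (hf.equiv hy) h
  simp only [map_sum, map_smul, LinearEquiv.conj_apply, LinearMap.comp_apply,
    LinearEquiv.coe_coe, LinearEquiv.apply_symm_apply, LinearEquiv.symm_symm] at h2
  rw [← h2]
  simp only [LinearMap.toMatrix_apply, LinearEquiv.conj_apply, LinearMap.comp_apply,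
    LinearEquiv.coe_coe, LinearEquiv.symm_symm]

/-- Links the explicit formula, whose smoothness is visible, with the matrix of the operator, whose
traces do not depend on coordinates. -/
theorem IsParametrization.shapeMatrix_eq (hf : IsParametrization U f) (hy : y ∈ U) (hc : 0 < c)
    (hφ : IsSpacelikeHypersurface c φ) (hη : IsUnitNormalField φ η) :
    shapeMatrix (φ ∘ f) (η ∘ f) y = LinearMap.toMatrix (stdBasis m) (stdBasis m)
      ((hf.equiv hy).symm.conj (shapeOperator c φ η (f y))) := by
  set A := LinearMap.toMatrix (stdBasis m) (stdBasis m)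
      ((hf.equiv hy).symm.conj (shapeOperator c φ η (f y))) with hA
  have h1 : (Matrix.of fun i j => -lorentz m (dd j (η ∘ f) y) (dd i (φ ∘ f) y))
      = gram (φ ∘ f) y * A := by
    ext i j
    simp only [Matrix.of_apply, Matrix.mul_apply]
    rw [hf.dd_comp hy hη.smooth, hf.dd_comp hy hφ.smooth, differential_normal hc hφ hη,
      hf.shapeOperator_apply hy]
    simp only [map_neg, map_sum, map_smul, LinearMap.neg_apply, LinearMap.sum_apply,
      LinearMap.smul_apply, smul_eq_mul, neg_neg]
    refine Finset.sum_congr rfl fun k _ => ?_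
    rw [gram_symm, hf.gram_apply hy hφ, mul_comm]
    rfl
  rw [shapeMatrix, h1, Matrix.nonsing_inv_mul_cancel_left]
  exact isUnit_iff_ne_zero.2 (hf.gram_det_ne_zero hy hφ)

theorem IsParametrization.shapeOperator_frame (hf : IsParametrization U f) (hy : y ∈ U)
    (hc : 0 < c) (hφ : IsSpacelikeHypersurface c φ) (hη : IsUnitNormalField φ η)
    (j : Fin m) : shapeOperator c φ η (f y) (hf.equiv hy (stdBasis m j))
      = ∑ i, shapeMatrix (φ ∘ f) (η ∘ f) y i j • hf.equiv hy (stdBasis m i) := by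
  rw [hf.shapeMatrix_eq hy hc hφ hη]
  exact hf.shapeOperator_apply hy j

theorem IsParametrization.trace_shapeMatrix (hf : IsParametrization U f) (hy : y ∈ U) (hc : 0 < c)
    (hφ : IsSpacelikeHypersurface c φ) (hη : IsUnitNormalField φ η) :
    ∑ i, shapeMatrix (φ ∘ f) (η ∘ f) y i i
      = LinearMap.trace ℝ _ (shapeOperator c φ η (f y)) := by
  rw [hf.shapeMatrix_eq hy hc hφ hη]
  change Matrix.trace _ = _
  rw [← LinearMap.trace_eq_matrix_trace, LinearMap.trace_conj']

theorem IsParametrization.trace_shapeMatrix_sq (hf : IsParametrization U f) (hy : y ∈ U)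
    (hc : 0 < c) (hφ : IsSpacelikeHypersurface c φ) (hη : IsUnitNormalField φ η) :
    ∑ i, ∑ j, shapeMatrix (φ ∘ f) (η ∘ f) y i j * shapeMatrix (φ ∘ f) (η ∘ f) y j i
      = LinearMap.trace ℝ _ (shapeOperator c φ η (f y) ∘ₗ shapeOperator c φ η (f y)) := by
  rw [← LinearMap.trace_conj' _ (hf.equiv hy).symm, LinearEquiv.conj_comp,
    LinearMap.trace_eq_matrix_trace ℝ (stdBasis m), LinearMap.toMatrix_comp _ (stdBasis m),
    ← hf.shapeMatrix_eq hy hc hφ hη]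
  rfl

theorem IsParametrization.isSmoothOn_gram (hf : IsParametrization U f)
    (hφ : IsSpacelikeHypersurface c φ) (i j : Fin m) :
    IsSmoothOn U (fun y => gram (φ ∘ f) y i j) :=
  ((hf.isSmoothOn_comp hφ.smooth).dd i).bilin (lorentzCLM m) ((hf.isSmoothOn_comp hφ.smooth).dd j)

theorem IsParametrization.isSmoothOn_shapeMatrix (hf : IsParametrization U f)
    (hφ : IsSpacelikeHypersurface c φ) (hη : IsUnitNormalField φ η) (i j : Fin m) :
    IsSmoothOn U (fun y => shapeMatrix (φ ∘ f) (η ∘ f) y i j) := by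
  simp only [shapeMatrix, Matrix.mul_apply]
  refine IsSmoothOn.sum fun k => IsSmoothOn.mul ?_ ?_
  · exact IsSmoothOn.matrix_inv (hf.isSmoothOn_gram hφ) (fun z hz => hf.gram_det_ne_zero hz hφ) i k
  · intro z hz
    exact (((hf.isSmoothOn_comp hη.smooth).dd j).bilin (lorentzCLM m)
      ((hf.isSmoothOn_comp hφ.smooth).dd k) z hz).neg

theorem IsParametrization.isLocalHypersurface (hf : IsParametrization U f) (hc : 0 < c)
    (hφ : IsSpacelikeHypersurface c φ) (hη : IsUnitNormalField φ η) :
    IsLocalHypersurface (lorentzCLM m) c U (φ ∘ f) (η ∘ f)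
      (fun i j y => shapeMatrix (φ ∘ f) (η ∘ f) y i j) where
  symm := lorentz_comm
  isOpen := hf.isOpen
  smooth := hf.isSmoothOn_comp hφ.smooth
  smooth_normal := hf.isSmoothOn_comp hη.smooth
  smooth_shape := hf.isSmoothOn_shapeMatrix hφ hη
  sq z hz := by
    rw [lorentzCLM_apply, Function.comp_apply, hφ.lorentz_self, mul_one_div_cancel hc.ne']
  sq_normal z hz := hη.unit _
  normal_pos z hz := hη.tangent _
  normal i z hz := by
    rw [hf.dd_comp hz hφ.smooth]
    exact hη.normal _ _
  weingarten j z hz := by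
    rw [hf.dd_comp hz hη.smooth, differential_normal hc hφ hη,
      hf.shapeOperator_frame hz hc hφ hη]
    simp only [map_sum, map_smul, hf.dd_comp hz hφ.smooth]
  eq_zero z hz v hvx hvn hvi := by
    refine eq_zero_of_orthogonal_hypersurface hc hφ hη (f z) hvx hvn fun w => ?_
    obtain ⟨w, rfl⟩ := (hf.equiv hz).surjective w
    rw [← (stdBasis m).sum_repr w]
    simp only [map_sum, map_smul, smul_eq_mul]
    refine Finset.sum_eq_zero fun i _ => ?_
    have := hvi i
    rw [hf.dd_comp hz hφ.smooth] at this
    rw [lorentzCLM_apply] at this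
    rw [this, mul_zero]

theorem chart_symm_apply_self (p : M) :
    (chartAt (Model m) p).symm (chartAt (Model m) p p) = p :=
  (chartAt (Model m) p).left_inv (mem_chart_source _ p)

variable [IsManifold 𝓘(ℝ, Model m) ∞ M]

theorem isParametrization_chart (p : M) :
    IsParametrization (chartAt (Model m) p).target (chartAt (Model m) p).symm where
  isOpen := (chartAt (Model m) p).open_target
  smooth z hz := (contMDiffOn_chart_symm (I := 𝓘(ℝ, Model m)) (n := ∞) (x := p)).contMDiffAt
    ((chartAt (Model m) p).open_target.mem_nhds hz)
  injective z hz := by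
    have : IsManifold 𝓘(ℝ, Model m) 1 M := IsManifold.of_le (n := ∞) (by simp)
    exact (mdifferentiable_chart (I := 𝓘(ℝ, Model m)) p).symm.mfderiv_injective hz

/-- The trace of the shape operator is smooth. -/
theorem contMDiff_trace_shapeOperator (hc : 0 < c)
    (hφ : IsSpacelikeHypersurface c φ) (hη : IsUnitNormalField φ η) :
    ContMDiff 𝓘(ℝ, Model m) 𝓘(ℝ, ℝ) ∞
      (fun p : M => LinearMap.trace ℝ _ (shapeOperator c φ η p)) := by
  intro p
  have hf := isParametrization_chart (m := m) p
  set H := fun p : M => LinearMap.trace ℝ _ (shapeOperator c φ η p) with hH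
  have h1 : IsSmoothOn (chartAt (Model m) p).target (H ∘ (chartAt (Model m) p).symm) := by
    intro z hz
    refine ((IsSmoothOn.sum fun i => hf.isSmoothOn_shapeMatrix hφ hη i i) z hz
      ).congr_of_eventuallyEq ?_
    filter_upwards [hf.isOpen.mem_nhds hz] with w hw
    exact (hf.trace_shapeMatrix hw hc hφ hη).symm
  have h2 : ContMDiffAt 𝓘(ℝ, Model m) 𝓘(ℝ, Model m) ∞ (chartAt (Model m) p) p :=
    (contMDiffOn_chart (I := 𝓘(ℝ, Model m)) (n := ∞) (x := p)).contMDiffAt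
      (chart_source_mem_nhds _ p)
  have h3 := (contMDiffAt_iff_contDiffAt.2
    (h1 _ (mem_chart_target (Model m) p))).comp p h2
  refine h3.congr_of_eventuallyEq ?_
  filter_upwards [chart_source_mem_nhds (Model m) p] with q hq
  simp [(chartAt (Model m) p).left_inv hq]

end ShapeOperator

/-! ### Index algebra for contractions of the Gauss equation. -/

theorem sum_swap_outer_inner {ι : Type*} [Fintype ι] (T : ι → ι → ι → ι → ℝ) :
    ∑ n, ∑ k, ∑ i, ∑ j, T j k i n = ∑ j, ∑ k, ∑ i, ∑ n, T j k i n := by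
  have h1 : ∀ n, ∑ k, ∑ i, ∑ j, T j k i n = ∑ j, ∑ k, ∑ i, T j k i n := fun n =>
    (Finset.sum_congr rfl fun k _ => Finset.sum_comm).trans Finset.sum_comm
  have h2 : ∀ j, ∑ n, ∑ k, ∑ i, T j k i n = ∑ k, ∑ i, ∑ n, T j k i n := fun j =>
    Finset.sum_comm.trans (Finset.sum_congr rfl fun k _ => Finset.sum_comm)
  rw [Finset.sum_congr rfl fun n _ => h1 n, Finset.sum_comm, Finset.sum_congr rfl fun j _ => h2 j]

/-- With P the inverse metric, this is the double trace of an expression of Gauss type. It serves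
twice, with S the metric and with S the second fundamental form. -/
theorem trace_gauss {m : ℕ} (P S : Matrix (Fin m) (Fin m) ℝ) (hP : ∀ i j, P i j = P j i)
    (hS : ∀ i j, S i j = S j i) :
    ∑ j, ∑ k, P j k * ∑ i, ∑ n, P n i * (S j k * S i n - S i k * S j n)
      = (∑ i, (P * S) i i) ^ 2 - ∑ i, ∑ j, (P * S) i j * (P * S) j i := by
  have e1 : ∑ i, (P * S) i i = ∑ j, ∑ k, P j k * S j k := by
    simp only [Matrix.mul_apply]
    exact Finset.sum_congr rfl fun i _ => Finset.sum_congr rfl fun k _ => by rw [hS]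
  have e2 : ∑ i, (P * S) i i = ∑ i, ∑ n, P n i * S i n := by
    simp only [Matrix.mul_apply]
    exact Finset.sum_congr rfl fun i _ => Finset.sum_congr rfl fun k _ => by rw [hP, hS]
  have e3 : ∑ i, ∑ j, (P * S) i j * (P * S) j i
      = ∑ j, ∑ k, P j k * ∑ i, ∑ n, P n i * (S i k * S j n) := by
    simp only [Matrix.mul_apply, Finset.sum_mul_sum]
    simp only [Finset.mul_sum]
    rw [sum_swap_outer_inner fun j k i n => P n i * S i k * (P k j * S j n)]
    refine Finset.sum_congr rfl fun j _ => Finset.sum_congr rfl fun k _ =>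
      Finset.sum_congr rfl fun i _ => Finset.sum_congr rfl fun n _ => ?_
    rw [hP k j]
    ring
  rw [e3, pow_two]
  nth_rewrite 1 [e1]
  rw [e2, Finset.sum_mul, ← Finset.sum_sub_distrib]
  refine Finset.sum_congr rfl fun j _ => ?_
  rw [Finset.sum_mul, ← Finset.sum_sub_distrib]
  refine Finset.sum_congr rfl fun k _ => ?_
  rw [mul_assoc, ← mul_sub]
  congr 1
  rw [Finset.mul_sum, ← Finset.sum_sub_distrib]
  refine Finset.sum_congr rfl fun i _ => ?_
  rw [Finset.mul_sum, ← Finset.sum_sub_distrib]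
  exact Finset.sum_congr rfl fun n _ => by ring

theorem sum_mul_sum_comm {ι : Type*} [Fintype ι] (a b : ι → ι → ℝ) :
    (∑ i, ∑ n, a i n) * (∑ j, ∑ k, b j k) = ∑ i, ∑ j, ∑ k, ∑ n, a i n * b j k := by
  rw [Finset.sum_mul_sum]
  refine Finset.sum_congr rfl fun i _ => Finset.sum_congr rfl fun j _ => ?_
  rw [Finset.sum_mul_sum, Finset.sum_comm]

/-- The same expression evaluated on (X, Y, Y, X), as needed for sectional curvature; again Q is the
metric or the second fundamental form. -/
theorem sum_gauss {m : ℕ} (Q : Matrix (Fin m) (Fin m) ℝ) (X Y : Model m) :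
    ∑ i, ∑ j, ∑ k, ∑ n, (Q j k * Q i n - Q i k * Q j n) * X i * Y j * Y k * X n
      = (∑ i, ∑ j, Q i j * X i * X j) * (∑ i, ∑ j, Q i j * Y i * Y j)
        - (∑ i, ∑ j, Q i j * X i * Y j) * ∑ i, ∑ j, Q i j * Y i * X j := by
  have h : ∑ i, ∑ j, ∑ k, ∑ n, Q i k * X i * Y k * (Q j n * Y j * X n)
      = (∑ i, ∑ j, Q i j * X i * Y j) * ∑ i, ∑ j, Q i j * Y i * X j := by
    rw [sum_mul_sum_comm]
    refine Finset.sum_congr rfl fun i _ => Finset.sum_congr rfl fun j _ => Finset.sum_comm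
  rw [sum_mul_sum_comm, ← h]
  simp only [← Finset.sum_sub_distrib]
  refine Finset.sum_congr rfl fun i _ => Finset.sum_congr rfl fun j _ =>
    Finset.sum_congr rfl fun k _ => Finset.sum_congr rfl fun n _ => ?_
  ring

/-! ### Scalar and sectional curvature in terms of the shape operator. -/

section GaussEquation

variable {m : ℕ} {M : Type*} [TopologicalSpace M] [ChartedSpace (Model m) M]
  {c : ℝ} {φ η : M → Ambient m} {U : Set (Model m)} {f : Model m → M} {y : Model m}

theorem IsParametrization.gram_mul_shapeMatrix_symm (hf : IsParametrization U f) (hy : y ∈ U)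
    (hc : 0 < c) (hφ : IsSpacelikeHypersurface c φ) (hη : IsUnitNormalField φ η) (i j : Fin m) :
    ∑ k, shapeMatrix (φ ∘ f) (η ∘ f) y k i * gram (φ ∘ f) y k j
      = ∑ k, shapeMatrix (φ ∘ f) (η ∘ f) y k j * gram (φ ∘ f) y k i :=
  (hf.isLocalHypersurface hc hφ hη).shape_symm hy i j

theorem IsParametrization.metric_shapeOperator_frame (hf : IsParametrization U f) (hy : y ∈ U)
    (hc : 0 < c) (hφ : IsSpacelikeHypersurface c φ) (hη : IsUnitNormalField φ η) (i j : Fin m) :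
    inducedMetric φ (f y) (shapeOperator c φ η (f y) (hf.equiv hy (stdBasis m i)))
      (hf.equiv hy (stdBasis m j))
      = ∑ k, shapeMatrix (φ ∘ f) (η ∘ f) y k i * gram (φ ∘ f) y k j := by
  rw [hf.shapeOperator_frame hy hc hφ hη]
  simp only [map_sum, map_smul, LinearMap.sum_apply, LinearMap.smul_apply, smul_eq_mul,
    hf.gram_apply hy hφ]

/-- The equation `f y = p` is a hypothesis because a chart composed with its inverse returns `p`
only up to a propositional equality; the isomorphism then lands in the tangent space at `p` itself.
-/
theorem IsParametrization.exists_equiv (hf : IsParametrization U f) (hy : y ∈ U)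
    (hc : 0 < c) (hφ : IsSpacelikeHypersurface c φ) (hη : IsUnitNormalField φ η) {p : M}
    (hp : f y = p) : ∃ e : Model m ≃ₗ[ℝ] TangentSpace 𝓘(ℝ, Model m) p,
      (∀ i j, gram (φ ∘ f) y i j = inducedMetric φ p (e (stdBasis m i)) (e (stdBasis m j))) ∧
      ∀ i j, inducedMetric φ p (shapeOperator c φ η p (e (stdBasis m i))) (e (stdBasis m j))
        = ((shapeMatrix (φ ∘ f) (η ∘ f) y).transpose * gram (φ ∘ f) y) i j := by
  subst hp
  exact ⟨hf.equiv hy, hf.gram_apply hy hφ, hf.metric_shapeOperator_frame hy hc hφ hη⟩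

/-- The differential of a real function. -/
def scalarDifferential (H : M → ℝ) (p : M) : TangentSpace 𝓘(ℝ, Model m) p →ₗ[ℝ] ℝ :=
  (mfderiv 𝓘(ℝ, Model m) 𝓘(ℝ, ℝ) H p).toLinearMap

variable (c φ η) in
/-- The trace of the shape operator. -/
def shapeTrace (p : M) : ℝ := LinearMap.trace ℝ _ (shapeOperator c φ η p)

variable [IsManifold 𝓘(ℝ, Model m) ∞ M]

/-- The shape operator is self-adjoint. -/
theorem shapeOperator_symm (hc : 0 < c) (hφ : IsSpacelikeHypersurface c φ)
    (hη : IsUnitNormalField φ η) (p : M) (v w : TangentSpace 𝓘(ℝ, Model m) p) :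
    inducedMetric φ p (shapeOperator c φ η p v) w
      = inducedMetric φ p (shapeOperator c φ η p w) v := by
  have hf := isParametrization_chart (m := m) p
  have hy := mem_chart_target (Model m) p
  obtain ⟨e, -, he⟩ := hf.exists_equiv hy hc hφ hη (chart_symm_apply_self p)
  have hsy := hf.gram_mul_shapeMatrix_symm hy hc hφ hη
  obtain ⟨v, rfl⟩ := e.surjective v
  obtain ⟨w, rfl⟩ := e.surjective w
  rw [← (stdBasis m).sum_repr v, ← (stdBasis m).sum_repr w]
  simp only [map_sum, map_smul, LinearMap.sum_apply, LinearMap.smul_apply, smul_eq_mul,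
    he, Matrix.mul_apply, Matrix.transpose_apply]
  rw [Finset.sum_congr rfl fun i _ => Finset.mul_sum _ _ _,
    Finset.sum_congr rfl fun i _ => Finset.mul_sum _ _ _, Finset.sum_comm]
  refine Finset.sum_congr rfl fun i _ => Finset.sum_congr rfl fun j _ => ?_
  rw [hsy]
  ring

/-- Biconservativity in dual form: self-adjointness moves A from the gradient to the test vector,
and f = -H/m turns the factor m f / 2 into -H/2. -/
theorem biconservative_trace (hm : 1 ≤ m) (hc : 0 < c) (hφ : IsSpacelikeHypersurface c φ)
    (hη : IsUnitNormalField φ η) (hbic : IsBiconservative c φ η) (p : M)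
    (v : TangentSpace 𝓘(ℝ, Model m) p) :
    scalarDifferential (shapeTrace c φ η) p (shapeOperator c φ η p v)
      = -(1 / 2 : ℝ) * (shapeTrace c φ η p * scalarDifferential (shapeTrace c φ η) p v) := by
  have hm0 : (m : ℝ) ≠ 0 := by positivity
  have hHd : MDifferentiableAt 𝓘(ℝ, Model m) 𝓘(ℝ, ℝ) (shapeTrace c φ η) p :=
    (contMDiff_trace_shapeOperator hc hφ hη p).mdifferentiableAt (by simp)
  have hmc : meanCurvature c φ η = (-(1 / (m : ℝ))) • shapeTrace c φ η := by
    funext q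
    simp only [meanCurvature, shapeTrace, Pi.smul_apply, smul_eq_mul]
    ring
  have hd : ∀ w : TangentSpace 𝓘(ℝ, Model m) p,
      scalarDifferential (meanCurvature c φ η) p w
      = (-(1 / (m : ℝ))) * scalarDifferential (shapeTrace c φ η) p w := fun w => by
    unfold scalarDifferential
    rw [hmc, (hHd.hasMFDerivAt.const_smul (-(1 / (m : ℝ)))).mfderiv]
    rfl
  have hg : ∀ w, inducedMetric φ p (gradient (inducedMetric φ) (meanCurvature c φ η) p) w
      = (-(1 / (m : ℝ))) * scalarDifferential (shapeTrace c φ η) p w := fun w =>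
    (hφ.metric_sharp p _ w).trans (hd w)
  have h1 := congrArg (fun u => inducedMetric φ p u v) (hbic p)
  rw [shapeOperator_symm hc hφ hη, map_smul, LinearMap.smul_apply, hg,
    show inducedMetric φ p (shapeOperator c φ η p v)
        (gradient (inducedMetric φ) (meanCurvature c φ η) p)
      = inducedMetric φ p (gradient (inducedMetric φ) (meanCurvature c φ η) p)
        (shapeOperator c φ η p v) from lorentz_comm _ _, hg] at h1
  have h2 : meanCurvature c φ η p = -(1 / (m : ℝ)) * shapeTrace c φ η p := by rw [hmc]; rfl
  rw [h2, smul_eq_mul] at h1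
  field_simp at h1
  linarith

/-- The Gauss equation at `p`, in the chart around `p`. -/
theorem sum_curvatureCoord (hc : 0 < c) (hφ : IsSpacelikeHypersurface c φ)
    (hη : IsUnitNormalField φ η) (p : M) (G S A : Matrix (Fin m) (Fin m) ℝ)
    (hG : G = gram (φ ∘ (chartAt (Model m) p).symm) (chartAt (Model m) p p))
    (hA : A = shapeMatrix (φ ∘ (chartAt (Model m) p).symm) (η ∘ (chartAt (Model m) p).symm)
      (chartAt (Model m) p p))
    (hS : S = A.transpose * G) (i j k n : Fin m) :
    ∑ l, curvatureCoord (inducedMetric φ) p l i j k * G l n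
      = c * (G j k * G i n - G i k * G j n) - (S j k * S i n - S i k * S j n) := by
  have hf := isParametrization_chart (m := m) p
  have hy := mem_chart_target (Model m) p
  set f := (chartAt (Model m) p).symm with hfdef
  set x := chartAt (Model m) p p with hx
  have hloc := hf.isLocalHypersurface hc hφ hη
  have hmet : ∀ z ∈ (chartAt (Model m) p).target,
      metricCoord (inducedMetric φ) p z = gram (φ ∘ f) z := by
    intro z hz
    ext i j
    rw [hf.gram_apply hz hφ, stdBasis_apply, stdBasis_apply]
    rfl
  -- In Koszul's formula the derivatives of the induced metric combine to 2⟨∂_i ∂_j X, ∂_l X⟩. The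
  -- Christoffel symbols are thus the tangential components of ∂_i ∂_j X.
  have hΓ : ∀ k i j, ∀ z ∈ (chartAt (Model m) p).target,
      christoffel (inducedMetric φ) p k i j z
        = ∑ l, (gram (φ ∘ f) z)⁻¹ k l * lorentz m (dd i (dd j (φ ∘ f)) z) (dd l (φ ∘ f) z) := by
    intro k i j z hz
    have hp : ∀ i j l, partialDeriv i (fun y => metricCoord (inducedMetric φ) p y j l) z
        = lorentz m (dd i (dd j (φ ∘ f)) z) (dd l (φ ∘ f) z)
          + lorentz m (dd j (φ ∘ f) z) (dd i (dd l (φ ∘ f)) z) := by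
      intro i j l
      have e1 := dd_congr hf.isOpen (fun z hz => congrFun (congrFun (hmet z hz) j) l) i z hz
      exact e1.trans (dd_bilin (lorentzCLM m) (hloc.smooth.dd j) (hloc.smooth.dd l) hz i)
    rw [christoffel, hmet z hz, Finset.mul_sum]
    refine Finset.sum_congr rfl fun l _ => ?_
    rw [hp, hp, hp, dd_comm hloc.smooth hz j i, dd_comm hloc.smooth hz l i,
      dd_comm hloc.smooth hz l j, lorentz_comm (dd j (φ ∘ f) z),
      lorentz_comm (dd i (φ ∘ f) z) (dd j (dd l (φ ∘ f)) z)]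
    ring
  let Γ : Fin m → Fin m → Fin m → Model m → ℝ := fun k i j z =>
    ∑ l, (gram (φ ∘ f) z)⁻¹ k l * lorentz m (dd i (dd j (φ ∘ f)) z) (dd l (φ ∘ f) z)
  have hΓs : ∀ k i j, IsSmoothOn (chartAt (Model m) p).target (Γ k i j) := fun k i j =>
    IsSmoothOn.sum fun l => (IsSmoothOn.matrix_inv (hf.isSmoothOn_gram hφ)
      (fun z hz => hf.gram_det_ne_zero hz hφ) k l).mul
      (((hloc.smooth.dd j).dd i).bilin (lorentzCLM m) (hloc.smooth.dd l))
  have hΓeq : ∀ i j n, ∀ z ∈ (chartAt (Model m) p).target,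
      ∑ k, Γ k i j z * lorentzCLM m (dd k (φ ∘ f) z) (dd n (φ ∘ f) z)
        = lorentzCLM m (dd i (dd j (φ ∘ f)) z) (dd n (φ ∘ f) z) := by
    intro i j n z hz
    have hinv : (gram (φ ∘ f) z) * (gram (φ ∘ f) z)⁻¹ = 1 :=
      Matrix.mul_nonsing_inv _ (isUnit_iff_ne_zero.2 (hf.gram_det_ne_zero hz hφ))
    simp only [Γ, Finset.sum_mul]
    rw [Finset.sum_comm]
    have : ∀ l, ∑ k, (gram (φ ∘ f) z)⁻¹ k l * lorentz m (dd i (dd j (φ ∘ f)) z) (dd l (φ ∘ f) z)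
        * lorentzCLM m (dd k (φ ∘ f) z) (dd n (φ ∘ f) z)
        = lorentz m (dd i (dd j (φ ∘ f)) z) (dd l (φ ∘ f) z)
          * (gram (φ ∘ f) z * (gram (φ ∘ f) z)⁻¹) n l := by
      intro l
      rw [Matrix.mul_apply, Finset.mul_sum]
      refine Finset.sum_congr rfl fun k _ => ?_
      rw [gram_symm]
      simp only [gram, Matrix.of_apply, lorentzCLM_apply]
      ring
    simp_rw [this, hinv, Matrix.one_apply]
    simp
  have hSb : ∀ i j, S i j = ∑ k, shapeMatrix (φ ∘ f) (η ∘ f) x k i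
      * lorentzCLM m (dd k (φ ∘ f) x) (dd j (φ ∘ f) x) := by
    intro i j
    rw [hS, hA, hG]
    rfl
  have key := hloc.gauss hy Γ hΓs hΓeq S hSb i j k n
  have hcc : ∀ l, curvatureCoord (inducedMetric φ) p l i j k
      = dd i (Γ l j k) x - dd j (Γ l i k) x
        + ∑ s, (Γ l i s x * Γ s j k x - Γ l j s x * Γ s i k x) := by
    intro l
    have e1 := dd_congr hf.isOpen (hΓ l j k) i x hy
    have e2 := dd_congr hf.isOpen (hΓ l i k) j x hy
    simp only [curvatureCoord]
    change dd i (christoffel (inducedMetric φ) p l j k) x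
      - dd j (christoffel (inducedMetric φ) p l i k) x + _ = _
    rw [e1, e2]
    congr 1
    refine Finset.sum_congr rfl fun s _ => ?_
    rw [hΓ _ _ _ x hy, hΓ _ _ _ x hy, hΓ _ _ _ x hy, hΓ _ _ _ x hy]
  simp_rw [hcc]
  rw [hG]
  exact key

theorem metricCoord_self (hφ : IsSpacelikeHypersurface c φ) (p : M) :
    metricCoord (inducedMetric φ) p (chartAt (Model m) p p)
      = gram (φ ∘ (chartAt (Model m) p).symm) (chartAt (Model m) p p) := by
  ext i j
  rw [(isParametrization_chart (m := m) p).gram_apply (mem_chart_target _ p) hφ, stdBasis_apply,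
    stdBasis_apply]
  rfl

/-- The contracted Gauss equation. -/
theorem scalarCurvature_eq (hc : 0 < c) (hφ : IsSpacelikeHypersurface c φ)
    (hη : IsUnitNormalField φ η) (p : M) :
    scalarCurvature (inducedMetric φ) p = c * (m * m - m)
      - (shapeTrace c φ η p ^ 2
        - LinearMap.trace ℝ _ (shapeOperator c φ η p ∘ₗ shapeOperator c φ η p)) := by
  have hf := isParametrization_chart (m := m) p
  have hy := mem_chart_target (Model m) p
  have hgauss := sum_curvatureCoord hc hφ hη p _ _ _ rfl rfl rfl
  have ht1 := hf.trace_shapeMatrix hy hc hφ hη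
  have ht2 := hf.trace_shapeMatrix_sq hy hc hφ hη
  have hsymm := hf.gram_mul_shapeMatrix_symm hy hc hφ hη
  have hdet := hf.gram_det_ne_zero hy hφ
  have hGs := gram_symm (φ ∘ (chartAt (Model m) p).symm) (chartAt (Model m) p p)
  rw [chart_symm_apply_self] at ht1 ht2
  rw [scalarCurvature, metricCoord_self hφ, shapeTrace, ← ht1, ← ht2]
  generalize gram (φ ∘ (chartAt (Model m) p).symm) (chartAt (Model m) p p) = G at *
  generalize shapeMatrix (φ ∘ (chartAt (Model m) p).symm) (η ∘ (chartAt (Model m) p).symm)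
      (chartAt (Model m) p p) = A at *
  have hS : ∀ i j, (A.transpose * G) i j = (G * A) i j := by
    intro i j
    rw [Matrix.mul_apply, Matrix.mul_apply]
    simp only [Matrix.transpose_apply]
    rw [hsymm]
    refine Finset.sum_congr rfl fun k _ => ?_
    rw [hGs, mul_comm]
  have hSs : ∀ i j, (G * A) i j = (G * A) j i := by
    intro i j
    rw [← hS, ← hS, Matrix.mul_apply, Matrix.mul_apply]
    exact hsymm i j
  have hu : IsUnit G.det := isUnit_iff_ne_zero.2 hdet
  have hGt : G.transpose = G := by ext i j; exact hGs j i
  have hPs : ∀ i j, G⁻¹ i j = G⁻¹ j i := by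
    intro i j
    have : (G⁻¹).transpose = G⁻¹ := by rw [Matrix.transpose_nonsing_inv, hGt]
    rw [← this, Matrix.transpose_apply, this]
  have hPG : G⁻¹ * G = 1 := Matrix.nonsing_inv_mul _ hu
  have hGP : G * G⁻¹ = 1 := Matrix.mul_nonsing_inv _ hu
  have hPS : G⁻¹ * (G * A) = A := Matrix.nonsing_inv_mul_cancel_left _ _ hu
  simp only [hS] at hgauss
  -- The Gauss equation has its last index lowered; raising it again with G G⁻¹ = 1 permits the
  -- trace.
  have hric : ∀ j k, ricciCoord (inducedMetric φ) p j k
      = ∑ i, ∑ n, G⁻¹ n i * (c * (G j k * G i n - G i k * G j n)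
        - ((G * A) j k * (G * A) i n - (G * A) i k * (G * A) j n)) := by
    intro j k
    refine Finset.sum_congr rfl fun i _ => ?_
    simp_rw [← hgauss, Finset.mul_sum]
    rw [Finset.sum_comm]
    have : ∀ l, ∑ n, G⁻¹ n i * (curvatureCoord (inducedMetric φ) p l i j k * G l n)
        = curvatureCoord (inducedMetric φ) p l i j k * (G * G⁻¹) l i := by
      intro l
      rw [Matrix.mul_apply, Finset.mul_sum]
      exact Finset.sum_congr rfl fun n _ => by ring
    simp_rw [this, hGP, Matrix.one_apply]
    simp
  have h1 := trace_gauss G⁻¹ G hPs hGs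
  have h2 := trace_gauss G⁻¹ (G * A) hPs hSs
  rw [hPS] at h2
  rw [hPG] at h1
  -- For the metric part, P S is the identity, and (tr 1)² - tr 1 = m² - m.
  have h3 : (∑ i : Fin m, (1 : Matrix (Fin m) (Fin m) ℝ) i i) ^ 2
      - ∑ i, ∑ j, (1 : Matrix (Fin m) (Fin m) ℝ) i j * (1 : Matrix (Fin m) (Fin m) ℝ) j i
      = m * m - m := by
    simp [Matrix.one_apply, pow_two]
  rw [h3] at h1
  rw [← h1, ← h2]
  simp_rw [hric]
  rw [Finset.mul_sum, ← Finset.sum_sub_distrib]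
  refine Finset.sum_congr rfl fun j _ => ?_
  rw [Finset.mul_sum, ← Finset.sum_sub_distrib]
  refine Finset.sum_congr rfl fun k _ => ?_
  rw [mul_left_comm, ← mul_sub]
  congr 1
  rw [Finset.mul_sum, ← Finset.sum_sub_distrib]
  refine Finset.sum_congr rfl fun i _ => ?_
  rw [Finset.mul_sum, ← Finset.sum_sub_distrib]
  exact Finset.sum_congr rfl fun n _ => by ring

/-- The Gauss inequality for hypersurfaces of non-negative sectional curvature. -/
theorem sectional_nonneg (hc : 0 < c) (hφ : IsSpacelikeHypersurface c φ)
    (hη : IsUnitNormalField φ η)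
    (hsec : HasNonnegSectionalCurvature (inducedMetric φ)) (p : M)
    (v w : TangentSpace 𝓘(ℝ, Model m) p) (hvw : LinearIndependent ℝ ![v, w]) :
    0 ≤ c * (inducedMetric φ p v v * inducedMetric φ p w w - inducedMetric φ p v w ^ 2)
      - (inducedMetric φ p (shapeOperator c φ η p v) v
          * inducedMetric φ p (shapeOperator c φ η p w) w
        - inducedMetric φ p (shapeOperator c φ η p v) w ^ 2) := by
  have hf := isParametrization_chart (m := m) p
  have hy := mem_chart_target (Model m) p
  have hgauss := sum_curvatureCoord hc hφ hη p _ _ _ rfl rfl rfl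
  have hmet := metricCoord_self hφ p
  have hsy := shapeOperator_symm hc hφ hη p
  have hsecp := hsec p
  simp only [sectionalCurvature, curvatureForm, innerCoord, hmet] at hsecp
  obtain ⟨e, hg, hA⟩ := hf.exists_equiv hy hc hφ hη (chart_symm_apply_self p)
  generalize gram (φ ∘ (chartAt (Model m) p).symm) (chartAt (Model m) p p) = G at *
  generalize (shapeMatrix (φ ∘ (chartAt (Model m) p).symm) (η ∘ (chartAt (Model m) p).symm)
          (chartAt (Model m) p p)).transpose * G = S at *
  obtain ⟨X, rfl⟩ := e.surjective v
  obtain ⟨Y, rfl⟩ := e.surjective w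
  have hform : ∀ b : LinearMap.BilinForm ℝ (TangentSpace 𝓘(ℝ, Model m) p), ∀ X Y : Model m,
      b (e X) (e Y) = ∑ i, ∑ j, b (e (stdBasis m i)) (e (stdBasis m j)) * X i * Y j := by
    intro b X Y
    conv_lhs => rw [← (stdBasis m).sum_repr X, ← (stdBasis m).sum_repr Y]
    simp only [map_sum, map_smul, LinearMap.sum_apply, LinearMap.smul_apply, smul_eq_mul,
      Finset.mul_sum]
    rw [Finset.sum_comm]
    refine Finset.sum_congr rfl fun i _ => Finset.sum_congr rfl fun j _ => ?_
    simp [stdBasis]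
    ring
  have hG : ∀ X Y, inducedMetric φ p (e X) (e Y) = ∑ i, ∑ j, G i j * X i * Y j := fun X Y => by
    rw [hform]; simp_rw [hg]
  have hSf : ∀ X Y, inducedMetric φ p (shapeOperator c φ η p (e X)) (e Y)
      = ∑ i, ∑ j, S i j * X i * Y j := fun X Y => by
    have := hform (inducedMetric φ p ∘ₗ shapeOperator c φ η p) X Y
    simp only [LinearMap.comp_apply] at this
    rw [this]; simp_rw [hA]
  have hlin : LinearIndependent ℝ ![X, Y] := by
    refine LinearIndependent.of_comp e.toLinearMap ?_
    have h : e.toLinearMap ∘ ![X, Y] = ![e X, e Y] := by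
      funext i; fin_cases i <;> rfl
    rwa [h]
  have h0 := hsecp X Y hlin
  simp only [← hG] at h0
  -- The vector g(Y,Y) X - g(X,Y) Y is non-zero, and its squared length is g(Y,Y) times the Gram
  -- determinant.
  have hpos : 0 < inducedMetric φ p (e X) (e X) * inducedMetric φ p (e Y) (e Y)
      - inducedMetric φ p (e X) (e Y) ^ 2 := by
    have hY : 0 < inducedMetric φ p (e Y) (e Y) := hφ.spacelike p _ (hvw.ne_zero 1)
    have hu : inducedMetric φ p (e Y) (e Y) • e X + (-inducedMetric φ p (e X) (e Y)) • e Y ≠ 0 :=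
      fun h => hY.ne' (LinearIndependent.pair_iff.1 hvw _ _ h).1
    have h := hφ.spacelike p _ hu
    simp only [map_add, map_smul, LinearMap.add_apply, LinearMap.smul_apply, smul_eq_mul] at h
    rw [show inducedMetric φ p (e Y) (e X) = inducedMetric φ p (e X) (e Y)
      from lorentz_comm _ _] at h
    nlinarith [h, hY]
  rw [div_nonneg_iff] at h0
  have h1 := (h0.resolve_right fun h => absurd h.2 (not_le.2 hpos)).1
  refine h1.trans_eq ?_
  have h2 : ∀ i j k, ∑ l, ∑ n, curvatureCoord (inducedMetric φ) p l i j k * G l n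
      * X i * Y j * Y k * X n
      = ∑ n, (c * ((G j k * G i n - G i k * G j n) * X i * Y j * Y k * X n)
        - (S j k * S i n - S i k * S j n) * X i * Y j * Y k * X n) := fun i j k => by
    rw [Finset.sum_comm]
    refine Finset.sum_congr rfl fun n _ => ?_
    simp only [← Finset.sum_mul]
    rw [hgauss]
    ring
  simp only [h2, Finset.sum_sub_distrib, ← Finset.mul_sum]
  rw [sum_gauss, sum_gauss, ← hG, ← hG, ← hG, ← hG, ← hSf, ← hSf, ← hSf, ← hSf, hsy (e Y) (e X),
    show inducedMetric φ p (e Y) (e X) = inducedMetric φ p (e X) (e Y) from lorentz_comm _ _]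
  ring

end GaussEquation

/-! ### Simultaneous diagonalization. -/

theorem exists_transpose_mul_mul_eq_diagonal {m : ℕ} {S : Matrix (Fin m) (Fin m) ℝ}
    (hS : S.IsHermitian) : ∃ (P : Matrix (Fin m) (Fin m) ℝ),
      P.transpose * P = 1 ∧ P.transpose * S * P = Matrix.diagonal hS.eigenvalues := by
  refine ⟨hS.eigenvectorUnitary, ?_, ?_⟩
  · have := Unitary.coe_star_mul_self hS.eigenvectorUnitary
    rwa [Matrix.star_eq_conjTranspose, Matrix.conjTranspose_eq_transpose_of_trivial] at this
  · have := hS.conjStarAlgAut_star_eigenvectorUnitary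
    rw [Unitary.conjStarAlgAut_star_apply, Matrix.star_eq_conjTranspose,
      Matrix.conjTranspose_eq_transpose_of_trivial] at this
    rw [this]
    rfl

/-- Simultaneous diagonalization of a positive definite and a symmetric form. -/
theorem exists_simultaneous_diagonalization {m : ℕ} {G S : Matrix (Fin m) (Fin m) ℝ}
    (hG : G.PosDef) (hS : S.IsHermitian) : ∃ (P : Matrix (Fin m) (Fin m) ℝ) (lam : Fin m → ℝ),
      P.transpose * G * P = 1 ∧ P.transpose * S * P = Matrix.diagonal lam := by
  obtain ⟨Q, -, hQ⟩ := exists_transpose_mul_mul_eq_diagonal hG.1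
  -- `D` turns `G` into the identity; a further orthogonal matrix diagonalizes DᵀSD and leaves the
  -- identity unchanged.
  set D := Q * Matrix.diagonal fun i => (Real.sqrt (hG.1.eigenvalues i))⁻¹ with hD
  have hDG : D.transpose * G * D = 1 := by
    rw [hD, Matrix.transpose_mul, Matrix.diagonal_transpose]
    have : ∀ E : Matrix (Fin m) (Fin m) ℝ, E * Q.transpose * G * (Q * E)
        = E * (Q.transpose * G * Q) * E := fun E => by simp only [Matrix.mul_assoc]
    rw [this, hQ, Matrix.diagonal_mul_diagonal, Matrix.diagonal_mul_diagonal, ← Matrix.diagonal_one]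
    congr 1
    funext i
    have hpos := hG.eigenvalues_pos i
    have h1 := Real.mul_self_sqrt hpos.le
    have h2 : Real.sqrt (hG.1.eigenvalues i) ≠ 0 := (Real.sqrt_pos.2 hpos).ne'
    field_simp
    linarith [pow_two (Real.sqrt (hG.1.eigenvalues i))]
  have hDS : (D.transpose * S * D).IsHermitian := by
    have := Matrix.isHermitian_conjTranspose_mul_mul D hS
    rwa [Matrix.conjTranspose_eq_transpose_of_trivial] at this
  obtain ⟨P, hP1, hP⟩ := exists_transpose_mul_mul_eq_diagonal hDS
  have h : ∀ T : Matrix (Fin m) (Fin m) ℝ, (D * P).transpose * T * (D * P)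
      = P.transpose * (D.transpose * T * D) * P := fun T => by
    simp only [Matrix.transpose_mul, Matrix.mul_assoc]
  refine ⟨D * P, _, ?_, (h S).trans hP⟩
  rw [h, hDG, Matrix.mul_one, hP1]

/-! ### Quadratic changes of coordinates. -/

section Quadratic

variable {m : ℕ} {W : Type*} [NormedAddCommGroup W] [NormedSpace ℝ W]

theorem dd_coord (i j : Fin m) (y : Model m) :
    dd i (fun z : Model m => z j) y = if j = i then 1 else 0 := by
  unfold dd
  have h : HasFDerivAt (fun z : Model m => z j) (EuclideanSpace.proj j : Model m →L[ℝ] ℝ) y :=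
    (EuclideanSpace.proj j : Model m →L[ℝ] ℝ).hasFDerivAt
  rw [h.fderiv]
  simp

/-- A quadratic map with prescribed first and second derivatives at the origin. -/
theorem exists_quadratic_map (u : Model m) (v : Fin m → Model m) (G : Fin m → Fin m → Model m)
    (hG : ∀ i j, G i j = G j i) : ∃ ψ : Model m → Model m, ContDiff ℝ ∞ ψ ∧ ψ 0 = u ∧
      (∀ i, dd i ψ 0 = v i) ∧ ∀ i j, dd j (dd i ψ) 0 = -G i j := by
  have hcoord : ∀ i : Fin m, IsSmoothOn Set.univ (fun z : Model m => z i) := fun i z _ =>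
    (EuclideanSpace.proj i : Model m →L[ℝ] ℝ).contDiff.contDiffAt
  have hconst : ∀ w : Model m, IsSmoothOn Set.univ (fun _ : Model m => w) := fun w z _ =>
    contDiffAt_const
  have s1 : IsSmoothOn Set.univ (fun z : Model m => ∑ i, z i • v i) :=
    IsSmoothOn.sum fun i => (hcoord i).smul (hconst _)
  have s3 : ∀ i j, IsSmoothOn Set.univ (fun z : Model m => (z i * z j) • ((-(1 / 2 : ℝ)) • G i j)) :=
    fun i j => ((hcoord i).mul (hcoord j)).smul (hconst _)
  have s2 : IsSmoothOn Set.univ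
      (fun z : Model m => ∑ i, ∑ j, (z i * z j) • ((-(1 / 2 : ℝ)) • G i j)) :=
    IsSmoothOn.sum fun i => IsSmoothOn.sum (s3 i)
  -- The factor 1/2 offsets the symmetric double sum, in which the pairs (i, j) and (j, i) both
  -- contribute.
  set ψ : Model m → Model m := fun z => (u + ∑ i, z i • v i)
    + ∑ i, ∑ j, (z i * z j) • ((-(1 / 2 : ℝ)) • G i j) with hψ
  have s0 : IsSmoothOn Set.univ (fun z : Model m => u + ∑ i, z i • v i) := fun z hz =>
    contDiffAt_const.add (s1 z hz)
  have hsmooth : IsSmoothOn Set.univ ψ := fun z hz => (s0 z hz).add (s2 z hz)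
  have hd : ∀ i z, dd i ψ z = v i + ∑ j, z j • (-G i j) := by
    intro i z
    have hz := Set.mem_univ z
    rw [hψ, dd_add s0 s2 hz, dd_add (hconst u) s1 hz, dd_const, zero_add,
      dd_sum (fun k => (hcoord k).smul (hconst _)) hz,
      dd_sum (fun k => IsSmoothOn.sum (s3 k)) hz]
    simp_rw [fun k => dd_sum (s3 k) hz i, fun k => dd_smul (hcoord k) (hconst (v k)) hz i,
      fun k l => dd_smul ((hcoord k).mul (hcoord l)) (hconst ((-(1 / 2 : ℝ)) • G k l)) hz i,
      fun k l => dd_mul (hcoord k) (hcoord l) hz i, dd_const, dd_coord]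
    simp only [smul_zero, add_zero, add_smul, ite_smul, one_smul, zero_smul, ite_mul, mul_ite,
      one_mul, mul_one, zero_mul, mul_zero, Finset.sum_add_distrib, Finset.sum_ite_eq',
      Finset.mem_univ, if_true]
    congr 1
    have h1 : ∑ x, ∑ x_1, (if x = i then z x_1 • (-(1 / 2 : ℝ)) • G x x_1 else 0)
        = ∑ j, z j • (-(1 / 2 : ℝ)) • G i j := by
      rw [Finset.sum_comm]
      simp
    rw [h1, ← Finset.sum_add_distrib]
    refine Finset.sum_congr rfl fun j _ => ?_
    rw [hG j i]
    module
  refine ⟨ψ, contDiff_iff_contDiffAt.2 fun z => hsmooth z (Set.mem_univ z), ?_, ?_, ?_⟩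
  · simp [hψ]
  · intro i
    rw [hd]
    simp
  · intro i j
    have h0 := Set.mem_univ (0 : Model m)
    rw [dd_congr isOpen_univ (fun z _ => hd i z) j 0 h0,
      dd_add (hconst _) (IsSmoothOn.sum fun k => (hcoord k).smul (hconst _)) h0, dd_const, zero_add,
      dd_sum (fun k => (hcoord k).smul (hconst _)) h0]
    simp_rw [fun k => dd_smul (hcoord k) (hconst (-G i k)) h0 j, dd_const, dd_coord]
    simp

variable {V : Set (Model m)} {ψ : Model m → Model m} {F : Model m → W} {U : Set (Model m)}

theorem dd_comp_map (hψ : ContDiff ℝ ∞ ψ) (hF : IsSmoothOn U F) {z : Model m} (hz : ψ z ∈ U)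
    (i : Fin m) : dd i (F ∘ ψ) z = fderiv ℝ F (ψ z) (dd i ψ z) := by
  unfold dd
  rw [fderiv_comp z (hF.differentiableAt hz) (hψ.differentiable (by simp) z)]
  rfl

theorem dd_dd_comp_map (hU : IsOpen U) (hψ : ContDiff ℝ ∞ ψ) (hF : IsSmoothOn U F)
    {z : Model m} (hz : ψ z ∈ U) (i j : Fin m) :
    dd j (dd i (F ∘ ψ)) z = fderiv ℝ (fun w => fderiv ℝ F w (dd i ψ z)) (ψ z) (dd j ψ z)
      + fderiv ℝ F (ψ z) (dd j (dd i ψ) z) := by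
  have hV : IsOpen (ψ ⁻¹' U) := hU.preimage hψ.continuous
  rw [dd_congr hV (fun w hw => dd_comp_map hψ hF hw i) j z hz]
  have hdF : DifferentiableAt ℝ (fderiv ℝ F) (ψ z) :=
    ((hF _ hz).fderiv_right (m := ∞) (by simp)).differentiableAt (by simp)
  have hψs : IsSmoothOn Set.univ ψ := fun w _ => hψ.contDiffAt
  have hdψ : DifferentiableAt ℝ (dd i ψ) z := (hψs.dd i).differentiableAt (Set.mem_univ z)
  have h1 : HasFDerivAt (fun w => fderiv ℝ F (ψ w) (dd i ψ w)) _ z :=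
    (hdF.hasFDerivAt.comp z (hψ.differentiable (by simp) z).hasFDerivAt).clm_apply
      hdψ.hasFDerivAt
  have h2 : HasFDerivAt (fun w => fderiv ℝ F w (dd i ψ z)) _ (ψ z) :=
    hdF.hasFDerivAt.clm_apply (hasFDerivAt_const (dd i ψ z) (ψ z))
  rw [h2.fderiv]
  change fderiv ℝ (fun w => fderiv ℝ F (ψ w) (dd i ψ w)) z (EuclideanSpace.single j 1) = _
  rw [h1.fderiv]
  simp [dd, add_comm]

end Quadratic

/-! ### Normal principal coordinates and the elliptic inequality for H⁴. -/

section NormalCoordinates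

variable {m : ℕ} {M : Type*} [TopologicalSpace M] [ChartedSpace (Model m) M]
  {c : ℝ} {φ η : M → Ambient m} {U : Set (Model m)} {f : Model m → M}

theorem IsParametrization.comp (hf : IsParametrization U f) {ψ : Model m → Model m}
    (hψ : ContDiff ℝ ∞ ψ) : IsParametrization
      (ψ ⁻¹' U ∩ {z | IsUnit (fderiv ℝ ψ z)}) (f ∘ ψ) where
  isOpen := (hf.isOpen.preimage hψ.continuous).inter
    (Units.isOpen.preimage (hψ.continuous_fderiv (by simp)))
  smooth z hz := (hf.smooth (ψ z) hz.1).comp z (contMDiffAt_iff_contDiffAt.2 hψ.contDiffAt)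
  injective z hz := by
    have hd : DifferentiableAt ℝ ψ z := hψ.differentiable (by simp) z
    rw [mfderiv_comp z ((hf.smooth (ψ z) hz.1).mdifferentiableAt (by simp))
      hd.mdifferentiableAt, mfderiv_eq_fderiv]
    exact (hf.injective (ψ z) hz.1).comp (ContinuousLinearMap.isUnit_iff_bijective.1 hz.2).1

variable [IsManifold 𝓘(ℝ, Model m) ∞ M]

theorem IsParametrization.isHermitian_secondForm (hf : IsParametrization U f) {u : Model m}
    (hu : u ∈ U) (hc : 0 < c) (hφ : IsSpacelikeHypersurface c φ) (hη : IsUnitNormalField φ η) :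
    (Matrix.of fun i j => -lorentz m (dd j (η ∘ f) u) (dd i (φ ∘ f) u)).IsHermitian := by
  ext i j
  simp only [Matrix.conjTranspose_apply, Matrix.of_apply, star_trivial]
  rw [hf.dd_comp hu hη.smooth, hf.dd_comp hu hη.smooth, hf.dd_comp hu hφ.smooth,
    hf.dd_comp hu hφ.smooth, ← metric_shapeOperator hφ, ← metric_shapeOperator hφ,
    shapeOperator_symm hc hφ hη]

/-- The mean curvature satisfies the hypotheses of the Bochner type inequality in any coordinates
that are normal and principal at a point. -/
theorem IsParametrization.laplacian_nonneg (hf : IsParametrization U f) {x : Model m} (hx : x ∈ U)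
    (hm : 1 ≤ m) (hc : 0 < c) (hφ : IsSpacelikeHypersurface c φ) (hη : IsUnitNormalField φ η)
    (hsec : HasNonnegSectionalCurvature (inducedMetric φ))
    (hscal : ∃ s : ℝ, ∀ p : M, scalarCurvature (inducedMetric φ) p = s)
    (hbic : IsBiconservative c φ η) {lam : Fin m → ℝ}
    (hg : gram (φ ∘ f) x = 1)
    (hΓ : ∀ i j k, lorentz m (dd i (dd j (φ ∘ f)) x) (dd k (φ ∘ f) x) = 0)
    (hS : (Matrix.of fun i j => -lorentz m (dd j (η ∘ f) x) (dd i (φ ∘ f) x))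
      = Matrix.diagonal lam) :
    0 ≤ ∑ l, dd l (dd l (fun y => shapeTrace c φ η (f y) ^ 4)) x := by
  obtain ⟨s, hs⟩ := hscal
  have hA : shapeMatrix (φ ∘ f) (η ∘ f) x = Matrix.diagonal lam := by
    rw [shapeMatrix, hS, hg, inv_one, Matrix.one_mul]
  have hgx : ∀ i j, inducedMetric φ (f x) (hf.equiv hx (stdBasis m i)) (hf.equiv hx (stdBasis m j))
      = if i = j then 1 else 0 := fun i j => by
    rw [← hf.gram_apply hx hφ, hg, Matrix.one_apply]
  have hAx : ∀ i j, inducedMetric φ (f x) (shapeOperator c φ η (f x) (hf.equiv hx (stdBasis m i)))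
      (hf.equiv hx (stdBasis m j)) = if i = j then lam i else 0 := fun i j => by
    rw [hf.metric_shapeOperator_frame hx hc hφ hη, hA, hg]
    simp only [Matrix.diagonal_apply, Matrix.one_apply]
    by_cases hij : i = j
    · subst hij; simp
    · simp [hij, Ne.symm hij]
  -- The value of K comes from the contracted Gauss equation with scalar curvature s: |A|² = H² + s
  -- - c(m² - m).
  refine (hf.isLocalHypersurface hc hφ hη).laplacian_pow_four_nonneg (K := s - c * (m * m - m)) hx
    (lam := lam) (H := fun y => shapeTrace c φ η (f y)) ?_ hΓ ?_ ?_ ?_ ?_ ?_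
  · intro i j
    have := congrFun (congrFun hg i) j
    rwa [Matrix.one_apply] at this
  · intro i j
    rw [hA, Matrix.diagonal_apply]
  · intro y hy
    exact (hf.trace_shapeMatrix hy hc hφ hη).symm
  · intro y hy
    rw [hf.trace_shapeMatrix_sq hy hc hφ hη]
    have := scalarCurvature_eq hc hφ hη (f y)
    rw [hs] at this
    linarith
  · intro y hy j
    have hH := contMDiff_trace_shapeOperator hc hφ hη (f y)
    have hd : ∀ k, dd k (fun y => shapeTrace c φ η (f y)) y
        = scalarDifferential (shapeTrace c φ η) (f y) (hf.equiv hy (stdBasis m k)) := by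
      intro k
      have h := mfderiv_comp y (hH.mdifferentiableAt (by simp))
        ((hf.smooth y hy).mdifferentiableAt (by simp))
      rw [mfderiv_eq_fderiv] at h
      unfold dd
      rw [stdBasis_apply]
      exact congrArg (fun L => L (EuclideanSpace.single k 1)) h
    simp_rw [hd]
    have h := biconservative_trace hm hc hφ hη hbic (f y) (hf.equiv hy (stdBasis m j))
    rw [hf.shapeOperator_frame hy hc hφ hη] at h
    simpa only [map_sum, map_smul, smul_eq_mul] using h
  · intro i l hil
    have hli : LinearIndependent ℝ
        ![hf.equiv hx (stdBasis m i), hf.equiv hx (stdBasis m l)] := by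
      have h1 : LinearIndependent ℝ (hf.equiv hx ∘ stdBasis m) :=
        (stdBasis m).linearIndependent.map' (hf.equiv hx).toLinearMap (hf.equiv hx).ker
      have h2 := h1.comp ![i, l] (by
        intro a b hab
        fin_cases a <;> fin_cases b <;> simp_all [eq_comm])
      have h3 : (hf.equiv hx ∘ stdBasis m) ∘ ![i, l]
          = ![hf.equiv hx (stdBasis m i), hf.equiv hx (stdBasis m l)] := by
        funext a; fin_cases a <;> rfl
      rwa [h3] at h2
    have h := sectional_nonneg hc hφ hη hsec (f x) _ _ hli
    rw [hgx, hgx, hgx, hAx, hAx, hAx] at h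
    simpa [hil] using h

/-- At each point the fourth power of the mean curvature satisfies an elliptic differential
inequality, whose principal part is the inverse of the induced metric. -/
theorem IsParametrization.exists_elliptic_frame (hf : IsParametrization U f) {u : Model m}
    (hu : u ∈ U) (hm : 1 ≤ m) (hc : 0 < c) (hφ : IsSpacelikeHypersurface c φ)
    (hη : IsUnitNormalField φ η) (hsec : HasNonnegSectionalCurvature (inducedMetric φ))
    (hscal : ∃ s : ℝ, ∀ p : M, scalarCurvature (inducedMetric φ) p = s)
    (hbic : IsBiconservative c φ η) : ∃ v : Fin m → Model m,
      (∀ i j, lorentz m (fderiv ℝ (φ ∘ f) u (v i)) (fderiv ℝ (φ ∘ f) u (v j))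
        = if i = j then 1 else 0) ∧
      0 ≤ ∑ i, fderiv ℝ (fun z => fderiv ℝ (fun y => shapeTrace c φ η (f y) ^ 4) z (v i)) u (v i)
        + fderiv ℝ (fun y => shapeTrace c φ η (f y) ^ 4) u (-∑ i, ∑ k,
          lorentz m (fderiv ℝ (fun z => fderiv ℝ (φ ∘ f) z (v i)) u (v i))
            (fderiv ℝ (φ ∘ f) u (v k)) • v k) := by
  -- The columns of `P` are the components of an orthonormal basis of principal directions at `u`.
  obtain ⟨P, lam, hPG, hPS⟩ := exists_simultaneous_diagonalization (hf.gram_posDef hu hφ)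
    (hf.isHermitian_secondForm hu hc hφ hη)
  set X := φ ∘ f with hX
  have hXs : IsSmoothOn U X := hf.isSmoothOn_comp hφ.smooth
  have hNs : IsSmoothOn U (η ∘ f) := hf.isSmoothOn_comp hη.smooth
  let v : Fin m → Model m := fun i => ∑ k, P k i • stdBasis m k
  have hv : ∀ {F : Model m → Ambient m} (i : Fin m), fderiv ℝ F u (v i) = ∑ k, P k i • dd k F u :=
    fun i => by
      simp only [v, map_sum, map_smul, stdBasis_apply]
      rfl
  have hbil : ∀ F F' : Model m → Ambient m, ∀ i j,
      lorentz m (fderiv ℝ F u (v i)) (fderiv ℝ F' u (v j))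
        = (P.transpose * (Matrix.of fun k l => lorentz m (dd k F u) (dd l F' u)) * P) i j := by
    intro F F' i j
    rw [hv, hv]
    simp only [map_sum, map_smul, LinearMap.sum_apply, LinearMap.smul_apply, smul_eq_mul,
      Matrix.mul_apply, Matrix.transpose_apply, Matrix.of_apply, Finset.sum_mul]
    refine Finset.sum_congr rfl fun k _ => ?_
    rw [Finset.mul_sum]
    refine Finset.sum_congr rfl fun l _ => ?_
    ring
  have hvg : ∀ i j, lorentz m (fderiv ℝ X u (v i)) (fderiv ℝ X u (v j)) = if i = j then 1 else 0 :=
    fun i j => by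
      rw [hbil, ← Matrix.one_apply, ← hPG]
      rfl
  have hsymm2 : ∀ v w : Model m, fderiv ℝ (fun z => fderiv ℝ X z v) u w
      = fderiv ℝ (fun z => fderiv ℝ X z w) u v := by
    intro v w
    have hs : IsSymmSndFDerivAt ℝ X u := (hXs u hu).isSymmSndFDerivAt
      (by rw [minSmoothness_of_isRCLikeNormedField]; exact ENat.LEInfty.out)
    have hd : DifferentiableAt ℝ (fderiv ℝ X) u :=
      ((hXs u hu).fderiv_right (m := ∞) (by simp)).differentiableAt (by simp)
    rw [fderiv_clm_apply hd (differentiableAt_const v),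
      fderiv_clm_apply hd (differentiableAt_const w)]
    simpa using hs w v
  -- The tangential part of D²X(v_i, v_j). Prescribing the second derivatives of ψ as -Γ cancels it,
  -- so the new coordinates have vanishing Christoffel symbols at 0. The same correction is the
  -- first-order term of the inequality.
  let Γ : Fin m → Fin m → Model m := fun i j => ∑ k,
    lorentz m (fderiv ℝ (fun z => fderiv ℝ X z (v i)) u (v j)) (fderiv ℝ X u (v k)) • v k
  have hΓs : ∀ i j, Γ i j = Γ j i := fun i j => by simp only [Γ, hsymm2 (v i) (v j)]
  obtain ⟨ψ, hψ, hψ0, hψ1, hψ2⟩ := exists_quadratic_map u v Γ hΓs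
  have hpar := hf.comp hψ
  have hψU : ψ 0 ∈ U := by rwa [hψ0]
  have hX1 : ∀ i, dd i (X ∘ ψ) 0 = fderiv ℝ X u (v i) := fun i => by
    rw [dd_comp_map hψ hXs hψU, hψ0, hψ1]
  have hN1 : ∀ i, dd i ((η ∘ f) ∘ ψ) 0 = fderiv ℝ (η ∘ f) u (v i) := fun i => by
    rw [dd_comp_map hψ hNs hψU, hψ0, hψ1]
  have hX2 : ∀ i j, dd j (dd i (X ∘ ψ)) 0 = fderiv ℝ (fun z => fderiv ℝ X z (v i)) u (v j)
      - fderiv ℝ X u (Γ i j) := fun i j => by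
    rw [dd_dd_comp_map hf.isOpen hψ hXs hψU, hψ0, hψ1, hψ1, hψ2, map_neg, sub_eq_add_neg]
  have h0 : (0 : Model m) ∈ ψ ⁻¹' U ∩ {z | IsUnit (fderiv ℝ ψ z)} := by
    refine ⟨hψU, ContinuousLinearMap.isUnit_iff_bijective.2 ?_⟩
    have hinj : Function.Injective (fderiv ℝ ψ 0).toLinearMap := by
      rw [← LinearMap.ker_eq_bot, LinearMap.ker_eq_bot']
      intro w hw
      have h1 : fderiv ℝ ψ 0 w = ∑ i, w i • v i := by
        conv_lhs => rw [← (stdBasis m).sum_repr w]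
        simp only [map_sum, map_smul, stdBasis_apply]
        refine Finset.sum_congr rfl fun i _ => ?_
        rw [show fderiv ℝ ψ 0 (EuclideanSpace.single i 1) = v i from hψ1 i]
        simp [stdBasis]
      have h2 : ∑ i, w i • v i = 0 := h1.symm.trans hw
      ext j
      have h3 := congrArg (fun z => lorentz m (fderiv ℝ X u z) (fderiv ℝ X u (v j))) h2
      simpa [hvg] using h3
    exact ⟨hinj, LinearMap.injective_iff_surjective.1 hinj⟩
  refine ⟨v, hvg, ?_⟩
  have key := hpar.laplacian_nonneg h0 hm hc hφ hη hsec hscal hbic (lam := lam) ?_ ?_ ?_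
  · have hws : IsSmoothOn U (fun y => shapeTrace c φ η (f y) ^ 4) := fun z hz =>
      (contMDiffAt_iff_contDiffAt.1 ((contMDiff_trace_shapeOperator hc hφ hη (f z)).comp z
        (hf.smooth z hz))).pow 4
    have h1 : ∀ l, dd l (dd l (fun y => shapeTrace c φ η ((f ∘ ψ) y) ^ 4)) 0
        = fderiv ℝ (fun z => fderiv ℝ (fun y => shapeTrace c φ η (f y) ^ 4) z (v l)) u (v l)
          + fderiv ℝ (fun y => shapeTrace c φ η (f y) ^ 4) u (-Γ l l) := by
      intro l
      have := dd_dd_comp_map hf.isOpen hψ hws hψU l l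
      rw [hψ0, hψ1, hψ2] at this
      exact this
    simp_rw [h1] at key
    rw [Finset.sum_add_distrib, ← map_sum, Finset.sum_neg_distrib] at key
    exact key
  · ext i j
    rw [Matrix.one_apply, ← hvg i j, ← hX1, ← hX1]
    rfl
  · intro i j k
    have e : φ ∘ f ∘ ψ = X ∘ ψ := rfl
    rw [e, hX2, hX1, map_sub, LinearMap.sub_apply]
    simp only [Γ, map_sum, map_smul, LinearMap.sum_apply, LinearMap.smul_apply, hvg, smul_eq_mul]
    simp
  · ext i j
    rw [← hPS]
    have h1 := hbil X (η ∘ f) i j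
    have e : (Matrix.of fun i j => -lorentz m (dd j (η ∘ f) u) (dd i X u))
        = -(Matrix.of fun k l => lorentz m (dd k X u) (dd l (η ∘ f) u)) := by
      ext k l
      simp [lorentz_comm (dd k X u)]
    rw [e, Matrix.mul_neg, Matrix.neg_mul, Matrix.neg_apply, ← h1, ← hN1, ← hX1, lorentz_comm]
    rfl

end NormalCoordinates

/-! ### Uniform ellipticity. -/

theorem abs_lorentz_le {m : ℕ} (v w : Ambient m) :
    |lorentz m v w| ≤ ‖lorentzCLM m‖ * ‖v‖ * ‖w‖ := (lorentzCLM m).le_opNorm₂ v w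

/-- A frame that is orthonormal for a form bounded by `K` times the Euclidean one. -/
theorem ellipticity_of_orthonormal {m : ℕ} (L : Model m →L[ℝ] Ambient m) (v : Fin m → Model m)
    (hv : ∀ i j, lorentz m (L (v i)) (L (v j)) = if i = j then 1 else 0) {K : ℝ} (hK : 0 < K)
    (hL : ∀ ξ, lorentz m (L ξ) (L ξ) ≤ K * ‖ξ‖ ^ 2) (ξ : Model m) :
    K⁻¹ * ‖ξ‖ ^ 2 ≤ ∑ i, inner ℝ ξ (v i) ^ 2 := by
  have hli : LinearIndependent ℝ v := by
    rw [Fintype.linearIndependent_iff]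
    intro t ht j
    have h := congrArg (fun z => lorentz m (L z) (L (v j))) ht
    simpa [hv] using h
  obtain ⟨t, rfl⟩ : ∃ t : Fin m → ℝ, ∑ i, t i • v i = ξ := by
    have h := hli.span_eq_top_of_card_eq_finrank' (by simp)
    exact (Submodule.mem_span_range_iff_exists_fun ℝ).1 (h ▸ Submodule.mem_top)
  set ξ := ∑ i, t i • v i with hξ
  have h1 : lorentz m (L ξ) (L ξ) = ∑ i, t i ^ 2 := by
    simp only [hξ, map_sum, map_smul, LinearMap.sum_apply, LinearMap.smul_apply, hv, smul_eq_mul]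
    simp [pow_two]
  have h2 : ‖ξ‖ ^ 2 = ∑ i, t i * inner ℝ ξ (v i) := by
    rw [← real_inner_self_eq_norm_sq]
    conv_lhs => rw [hξ, inner_sum]
    exact Finset.sum_congr rfl fun i _ => by rw [inner_smul_right]
  -- Cauchy–Schwarz: ‖ξ‖⁴ ≤ (Σ t_i²)(Σ ⟨ξ, v_i⟩²), where Σ t_i² = ⟨Lξ, Lξ⟩ ≤ K‖ξ‖².
  have h3 := Finset.sum_mul_sq_le_sq_mul_sq Finset.univ t (fun i => inner ℝ ξ (v i))
  rw [← h2, ← h1] at h3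
  have h4 : 0 ≤ ∑ i, inner ℝ ξ (v i) ^ 2 := Finset.sum_nonneg fun i _ => sq_nonneg _
  rw [inv_mul_le_iff₀ hK]
  rcases (norm_nonneg ξ).eq_or_lt with h | h
  · rw [← h]; simp only [ne_eq, OfNat.ofNat_ne_zero, not_false_eq_true, zero_pow]; positivity
  · have h5 : ‖ξ‖ ^ 2 * ‖ξ‖ ^ 2 ≤ ‖ξ‖ ^ 2 * (K * ∑ i, inner ℝ ξ (v i) ^ 2) := by
      nlinarith [mul_le_mul_of_nonneg_right (hL ξ) h4]
    exact le_of_mul_le_mul_left h5 (by positivity)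

/-! ### Local constancy of H⁴ at its maxima. -/

section Global

variable {m : ℕ} {M : Type*} [TopologicalSpace M] [ChartedSpace (Model m) M]
  {c : ℝ} {φ η : M → Ambient m} {U : Set (Model m)} {f : Model m → M}

theorem IsParametrization.fderiv_comp_pos (hf : IsParametrization U f)
    (hφ : IsSpacelikeHypersurface c φ) {z v : Model m} (hz : z ∈ U) (hv : v ≠ 0) :
    0 < lorentz m (fderiv ℝ (φ ∘ f) z v) (fderiv ℝ (φ ∘ f) z v) := by
  have h := mfderiv_comp z ((hφ.smooth (f z)).mdifferentiableAt (by simp))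
    ((hf.smooth z hz).mdifferentiableAt (by simp))
  rw [mfderiv_eq_fderiv] at h
  have h1 : fderiv ℝ (φ ∘ f) z v = differential φ (f z) (hf.equiv hz v) :=
    congrArg (fun L => L v) h
  rw [h1]
  exact hφ.spacelike _ _ ((hf.equiv hz).map_ne_zero_iff.2 hv)

variable [IsManifold 𝓘(ℝ, Model m) ∞ M]

/-- On a compact coordinate ball the first and second derivatives of the immersion are bounded and
the induced metric is bounded below. These bounds control every pointwise orthonormal frame and its
first-order term, which is all the maximum principle needs. -/
theorem IsParametrization.eventually_eq_of_isMax (hf : IsParametrization U f) {u : Model m}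
    (hu : u ∈ U) (hm : 1 ≤ m) (hc : 0 < c) (hφ : IsSpacelikeHypersurface c φ)
    (hη : IsUnitNormalField φ η) (hsec : HasNonnegSectionalCurvature (inducedMetric φ))
    (hscal : ∃ s : ℝ, ∀ p : M, scalarCurvature (inducedMetric φ) p = s)
    (hbic : IsBiconservative c φ η)
    (hmax : ∀ p, shapeTrace c φ η p ^ 4 ≤ shapeTrace c φ η (f u) ^ 4) :
    ∀ᶠ z in nhds u, shapeTrace c φ η (f z) ^ 4 = shapeTrace c φ η (f u) ^ 4 := by
  obtain ⟨R₀, hR₀, hball⟩ := Metric.isOpen_iff.1 hf.isOpen u hu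
  set R := R₀ / 2 with hR
  have hRpos : 0 < R := by positivity
  have hKU : Metric.closedBall u R ⊆ U := (Metric.closedBall_subset_ball (by linarith)).trans hball
  have hK : IsCompact (Metric.closedBall u R) := isCompact_closedBall u R
  set X := φ ∘ f with hX
  have hXs : IsSmoothOn U X := hf.isSmoothOn_comp hφ.smooth
  have hD1 : ∀ z ∈ U, ContDiffAt ℝ ∞ (fderiv ℝ X) z := fun z hz =>
    (hXs z hz).fderiv_right (m := ∞) (by simp)
  obtain ⟨C₁, hC₁⟩ := hK.exists_bound_of_continuousOn (f := fderiv ℝ X)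
    (fun z hz => (hD1 z (hKU hz)).continuousAt.continuousWithinAt)
  obtain ⟨C₂, hC₂⟩ := hK.exists_bound_of_continuousOn (f := fderiv ℝ (fderiv ℝ X))
    (fun z hz => ((hD1 z (hKU hz)).fderiv_right (m := ∞)
      (by simp)).continuousAt.continuousWithinAt)
  have hu0 : u ∈ Metric.closedBall u R := Metric.mem_closedBall_self hRpos.le
  have hC₁0 : 0 ≤ C₁ := (norm_nonneg _).trans (hC₁ u hu0)
  have hC₂0 : 0 ≤ C₂ := (norm_nonneg _).trans (hC₂ u hu0)
  -- A positive lower bound for the metric on unit vectors over the compact ball; by homogeneity it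
  -- extends to all vectors.
  obtain ⟨μ, hμ, hμ'⟩ := (hK.prod (isCompact_sphere (0 : Model m) 1)).exists_forall_le'
    (f := fun q : Model m × Model m => lorentzCLM m (fderiv ℝ X q.1 q.2) (fderiv ℝ X q.1 q.2))
    (a := 0) (by
      intro q hq
      have h1 : ContinuousAt (fun q : Model m × Model m => fderiv ℝ X q.1 q.2) q :=
        ((hD1 q.1 (hKU hq.1)).continuousAt.comp continuousAt_fst).clm_apply continuousAt_snd
      exact (((lorentzCLM m).continuous.continuousAt.comp h1).clm_apply h1).continuousWithinAt)
    (fun q hq => hf.fderiv_comp_pos hφ (hKU hq.1) (by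
      rintro h
      have := hq.2
      rw [h] at this
      simp at this))
  have hlow : ∀ z ∈ Metric.closedBall u R, ∀ v : Model m,
      μ * ‖v‖ ^ 2 ≤ lorentz m (fderiv ℝ X z v) (fderiv ℝ X z v) := by
    intro z hz v
    rcases eq_or_ne v 0 with rfl | hv
    · simp
    have hn : ‖v‖ ≠ 0 := norm_ne_zero_iff.2 hv
    have h1 := hμ' (z, ‖v‖⁻¹ • v) ⟨hz, by simp [norm_smul, hn]⟩
    simp only [map_smul, smul_apply, smul_eq_mul, lorentzCLM_apply] at h1
    field_simp at h1
    linarith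
  set β := ‖lorentzCLM m‖ with hβ
  have hβ0 : 0 ≤ β := norm_nonneg (lorentzCLM m)
  -- The added 1 only ensures K > 0.
  set K := β * C₁ ^ 2 + 1 with hKdef
  have hKpos : 0 < K := by positivity
  -- A vector of unit length for the induced metric satisfies μ‖v‖² ≤ 1.
  set Λ := Real.sqrt μ⁻¹ with hΛ
  have hΛ0 : 0 ≤ Λ := Real.sqrt_nonneg _
  have hres := eq_of_elliptic_of_isMax (ι := Fin m)
    (u := fun z => shapeTrace c φ η (f z) ^ 4) (x₀ := u) (R := R) (lam := K⁻¹) (Λ := Λ)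
    (C := ∑ _i : Fin m, ∑ _k : Fin m, β * (C₂ * Λ * Λ) * (C₁ * Λ) * Λ) (inv_pos.2 hKpos) ?_ ?_
    (fun z _ => hmax (f z))
  · filter_upwards [Metric.ball_mem_nhds u (by positivity : 0 < R / 2)] with z hz using hres z hz
  · intro z hz
    have hzU := hKU (Metric.ball_subset_closedBall hz)
    exact ((contMDiffAt_iff_contDiffAt.1 ((contMDiff_trace_shapeOperator hc hφ hη (f z)).comp z
      (hf.smooth z hzU))).pow 4).of_le ENat.LEInfty.out
  · intro z hz
    have hzK := Metric.ball_subset_closedBall hz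
    have hzU := hKU hzK
    obtain ⟨v, hv, hL⟩ := hf.exists_elliptic_frame hzU hm hc hφ hη hsec hscal hbic
    have hvn : ∀ i, ‖v i‖ ≤ Λ := by
      intro i
      apply Real.le_sqrt_of_sq_le
      have := hlow z hzK (v i)
      rw [hv, if_pos rfl] at this
      rw [← one_div, le_div_iff₀ hμ]
      linarith
    have hX1 : ∀ w, ‖fderiv ℝ X z w‖ ≤ C₁ * ‖w‖ := fun w =>
      (fderiv ℝ X z).le_of_opNorm_le (hC₁ z hzK) w
    have hX2 : ∀ i, ‖fderiv ℝ (fun z => fderiv ℝ X z (v i)) z (v i)‖ ≤ C₂ * Λ * Λ := by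
      intro i
      have hd : DifferentiableAt ℝ (fderiv ℝ X) z := (hD1 z hzU).differentiableAt (by simp)
      rw [fderiv_clm_apply hd (differentiableAt_const (v i))]
      have h1 : ‖fderiv ℝ (fderiv ℝ X) z (v i) (v i)‖ ≤ C₂ * ‖v i‖ * ‖v i‖ :=
        ((fderiv ℝ (fderiv ℝ X) z).le_opNorm₂ _ _).trans
          (by gcongr; exact hC₂ z hzK)
      have h2 : C₂ * ‖v i‖ * ‖v i‖ ≤ C₂ * Λ * Λ := by
        gcongr <;> exact hvn i
      simpa using h1.trans h2
    refine ⟨v, _, hvn, ?_, ?_, hL⟩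
    · rw [norm_neg]
      refine (norm_sum_le _ _).trans (Finset.sum_le_sum fun i _ => ?_)
      refine (norm_sum_le _ _).trans (Finset.sum_le_sum fun k _ => ?_)
      rw [norm_smul, Real.norm_eq_abs]
      refine mul_le_mul ?_ (hvn k) (norm_nonneg _) (by positivity)
      refine (abs_lorentz_le _ _).trans ?_
      gcongr
      · exact hX2 i
      · exact (hX1 _).trans (by gcongr; exact hvn k)
    · refine ellipticity_of_orthonormal (fderiv ℝ X z) v hv hKpos fun ξ => ?_
      have h1 := (le_abs_self _).trans (abs_lorentz_le (fderiv ℝ X z ξ) (fderiv ℝ X z ξ))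
      have h2 : ‖lorentzCLM m‖ * ‖fderiv ℝ X z ξ‖ * ‖fderiv ℝ X z ξ‖
          ≤ β * (C₁ * ‖ξ‖) * (C₁ * ‖ξ‖) := by
        gcongr <;> exact hX1 ξ
      rw [hKdef]
      nlinarith [sq_nonneg ‖ξ‖]

end Global

end DeSitter

end

/-! ### Conclusion by compactness and connectedness. -/

theorem theorem3p1 {m : ℕ} (hm : 1 ≤ m) {c : ℝ} (hc : 0 < c)
    {M : Type*} [TopologicalSpace M] [T2Space M] [CompactSpace M] [ConnectedSpace M]
    [ChartedSpace (DeSitter.Model m) M] [IsManifold 𝓘(ℝ, DeSitter.Model m) ∞ M]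
    (φ η : M → DeSitter.Ambient m)
    (hφ : DeSitter.IsSpacelikeHypersurface c φ)
    (hη : DeSitter.IsUnitNormalField φ η)
    (hsec : DeSitter.HasNonnegSectionalCurvature (DeSitter.inducedMetric φ))
    (hscal : ∃ s : ℝ, ∀ p : M, DeSitter.scalarCurvature (DeSitter.inducedMetric φ) p = s)
    (hmin : ¬ DeSitter.IsMinimal c φ η)
    (hbic : DeSitter.IsBiconservative c φ η) :
    ∃ a : ℝ, ∀ p : M, DeSitter.meanCurvature c φ η p = a := by
  set H := DeSitter.shapeTrace c φ η with hH
  have hcont : Continuous H :=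
    (DeSitter.contMDiff_trace_shapeOperator hc hφ hη).continuous
  obtain ⟨p₀, -, hp₀⟩ := isCompact_univ.exists_isMaxOn Set.univ_nonempty
    (hcont.pow 4).continuousOn
  have hmax : ∀ p, H p ^ 4 ≤ H p₀ ^ 4 := fun p => hp₀ (Set.mem_univ p)
  have hclosed : IsClosed {p | H p ^ 4 = H p₀ ^ 4} :=
    isClosed_eq (hcont.pow 4) continuous_const
  -- Each point where H⁴ is maximal is treated in its own chart by the maximum principle.
  have hopen : IsOpen {p | H p ^ 4 = H p₀ ^ 4} := by
    rw [isOpen_iff_mem_nhds]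
    intro p hp
    have hp' : H p ^ 4 = H p₀ ^ 4 := hp
    have hsymm := DeSitter.chart_symm_apply_self (m := m) p
    have h := (DeSitter.isParametrization_chart (m := m) p).eventually_eq_of_isMax
      (mem_chart_target _ p) hm hc hφ hη hsec hscal hbic
      (by rw [hsymm]; intro q; exact (hmax q).trans_eq hp'.symm)
    rw [hsymm] at h
    have h2 := ((chartAt (DeSitter.Model m) p).continuousAt (mem_chart_source _ p)).eventually h
    filter_upwards [h2, chart_source_mem_nhds (DeSitter.Model m) p] with q hq hqs
    rw [(chartAt (DeSitter.Model m) p).left_inv hqs] at hq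
    exact hq.trans hp'
  have huniv := IsClopen.eq_univ ⟨hclosed, hopen⟩ ⟨p₀, rfl⟩
  have hsq : ∀ p, H p ^ 2 = H p₀ ^ 2 := fun p => by
    have h4 : H p ^ 4 = H p₀ ^ 4 := by
      have : p ∈ {p | H p ^ 4 = H p₀ ^ 4} := huniv ▸ Set.mem_univ p
      exact this
    exact (pow_left_inj₀ (sq_nonneg _) (sq_nonneg _) two_ne_zero).1 (by ring_nf; exact h4)
  obtain ⟨p₁, hp₁⟩ : ∃ p, H p ≠ 0 := by
    by_contra! h
    exact hmin fun p => by
      have := h p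
      simp only [hH, DeSitter.shapeTrace] at this
      simp [DeSitter.meanCurvature, this]
  -- Non-minimality makes the constant value of H² non-zero, so that the continuous function H
  -- cannot change sign on the connected manifold.
  have hne : H p₀ ≠ 0 := fun h => hp₁ (by simpa [h] using hsq p₁)
  have hconst : ∃ b, ∀ p, H p = b := by
    rcases isPreconnected_univ.eq_or_eq_neg_of_sq_eq hcont.continuousOn
      (continuous_const (y := H p₀)).continuousOn (fun p _ => hsq p) (fun _ => hne) with h | h
    · exact ⟨_, fun p => h (Set.mem_univ p)⟩
    · exact ⟨_, fun p => h (Set.mem_univ p)⟩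
  obtain ⟨b, hb⟩ := hconst
  refine ⟨-b / m, fun p => ?_⟩
  rw [← hb p]
  rfl
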